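/- Let $k$ be a field of characteristic zero and let $A$ be an associative, not necessarily unital $k$-algebra. Fix a free DG algebra resolution $(R,s)$ of $A$: $R$ is the graded tensor algebra $\bigoplus_{n\ge 1}W^{\otimes n}$ on a graded $k$-vector space $W$, $R^i=0$ for $i>0$, $s$ is a derivation of degree $+1$ with $s^2=0$, $H^i(R,s)=0$ for $i<0$, and an isomorphism of algebras $H^0(R,s)\cong A$ is fixed. Let $(B,\mathfrak m)$ be a commutative local Artinian $k$-algebra with $B/\mathfrak m=k$, and put $R_B=R\otimes_kB$. A deformation of the relations of $A$ with basis $B$ is a $B$-linear graded derivation $\delta$ of degree $+1$ of $R_B$ with $\operatorname{Im}\delta\subseteq R\otimes_k\mathfrak m$ and $(s+\delta)^2=0$. Two such, $\delta_1$ and $\delta_2$, are equivalent if there is a $B$-linear isomorphism of DG algebras $(R_B,s+\delta_1)\to(R_B,s+\delta_2)$ that commutes with the canonical maps $R_B\to R$. Let $\operatorname{Def}_{\mathrm{rel}}(B)$ be the set of equivalence classes. A flat deformation of $A$ with basis $B$ is an associative, not necessarily unital $B$-algebra $\tilde A$, flat over $B$, together with a fixed isomorphism of $k$-algebras $\tilde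 A\otimes_Bk\to A$. Two flat deformations are equivalent if there is an isomorphism of $B$-algebras between them that commutes with the canonical maps to $A$. Let $\operatorname{Def}_\flat(B)$ be the set of equivalence classes. For every deformation $\delta$ of the relations, $H^0(R_B,s+\delta)$, with the isomorphism $H^0(R_B,s+\delta)\otimes_Bk\to A$ induced by $R_B\to R$ and $H^0(R,s)\cong A$, is a flat deformation of $A$, and this induces a well-defined map $$G(B):\operatorname{Def}_{\mathrm{rel}}(B)\longrightarrow\operatorname{Def}_\flat(B),\qquad [\delta]\longmapsto [H^0(R_B,s+\delta)].$$ **Proposition.** For every such $B$, the map $G(B)$ is surjective; that is, every flat deformation of $A$ with basis $B$ is equivalent to $H^0(R_B,s+\delta)$ for some deformation $\delta$ of the relations of $A$ with basis $B$. -/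

import Mathlib

open scoped TensorProduct
open IsLocalRing (maximalIdeal ResidueField)

universe u

set_option linter.unusedSectionVars false

noncomputable section

/-! ## Differential graded algebras (associative, not necessarily unital) -/

section DG

variable {K S : Type*} [CommRing K] [NonUnitalRing S] [Module K S]
  [IsScalarTower K S S] [SMulCommClass K S S]

/-- `δ` is a `K`-linear derivation of degree `n` of the graded algebra `(S, gr)`, with the usual
sign `δ(ab) = δ(a) b + (-1)^{n|a|} a δ(b)`. -/
structure IsGradedDerivation (gr : ℤ → Submodule K S) (n : ℤ) (δ : S →ₗ[K] S) : Prop where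
  map_mem : ∀ {i : ℤ} {a : S}, a ∈ gr i → δ a ∈ gr (i + n)
  leibniz : ∀ {i : ℤ} {a : S}, a ∈ gr i → ∀ b : S,
    δ (a * b) = δ a * b + (n * i).negOnePow • (a * δ b)

variable (K S) in
/-- A differential graded `K`-algebra structure (cohomological convention, differential of
degree `+1`) on the not necessarily unital associative `K`-algebra `S`. -/
structure DGAlgebraStr where
  /-- the homogeneous components -/
  gr : ℤ → Submodule K S
  isInternal : DirectSum.IsInternal gr
  mul_mem : ∀ {i j : ℤ} {a b : S}, a ∈ gr i → b ∈ gr j → a * b ∈ gr (i + j)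
  /-- the differential -/
  d : S →ₗ[K] S
  isDerivation : IsGradedDerivation gr 1 d
  d_d : ∀ a : S, d (d a) = 0

namespace DGAlgebraStr

variable (X : DGAlgebraStr K S)

/-- The algebra `Z⁰` of cocycles of degree zero. -/
def cocycles : NonUnitalSubalgebra K S where
  carrier := {a | a ∈ X.gr 0 ∧ X.d a = 0}
  add_mem' {a b} ha hb := ⟨add_mem ha.1 hb.1, by rw [map_add, ha.2, hb.2, add_zero]⟩
  zero_mem' := ⟨zero_mem _, map_zero _⟩
  mul_mem' {a b} ha hb := ⟨by simpa using X.mul_mem ha.1 hb.1, by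
    rw [X.isDerivation.leibniz ha.1, ha.2, hb.2]; simp⟩
  smul_mem' c a ha := ⟨Submodule.smul_mem _ c ha.1, by rw [map_smul, ha.2, smul_zero]⟩

/-- The coboundaries `d(S⁻¹)` of degree zero, inside the cocycles. -/
def coboundaries : Submodule K X.cocycles where
  carrier := {z | ∃ b ∈ X.gr (-1), X.d b = (z : S)}
  add_mem' := by
    rintro z w ⟨b, hb, hz⟩ ⟨c, hc, hw⟩
    exact ⟨b + c, add_mem hb hc, by rw [map_add, hz, hw]; rfl⟩
  zero_mem' := ⟨0, zero_mem _, map_zero _⟩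
  smul_mem' := by
    rintro r z ⟨b, hb, hz⟩
    exact ⟨r • b, Submodule.smul_mem _ r hb, by rw [map_smul, hz]; rfl⟩

/-- The cohomology `H⁰ = Z⁰ / d(S⁻¹)`. -/
def H0 : Type _ := X.cocycles ⧸ X.coboundaries

instance : AddCommGroup X.H0 := inferInstanceAs (AddCommGroup (X.cocycles ⧸ X.coboundaries))

instance : Module K X.H0 := inferInstanceAs (Module K (X.cocycles ⧸ X.coboundaries))

/-- The class of a cocycle. -/
def toH0 : X.cocycles →ₗ[K] X.H0 := X.coboundaries.mkQ

lemma toH0_surjective : Function.Surjective X.toH0 := Submodule.mkQ_surjective _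

lemma toH0_eq_iff {z w : X.cocycles} :
    X.toH0 z = X.toH0 w ↔ ∃ b ∈ X.gr (-1), X.d b = (z : S) - w :=
  (Submodule.Quotient.eq X.coboundaries).trans Iff.rfl

lemma toH0_eq_zero_iff {z : X.cocycles} :
    X.toH0 z = 0 ↔ ∃ b ∈ X.gr (-1), X.d b = (z : S) :=
  (Submodule.Quotient.mk_eq_zero X.coboundaries).trans Iff.rfl

/-- A (semi)linear map on cocycles which kills the coboundaries induces a map on `H⁰`. -/
def liftH0 {L M : Type*} [Ring L] [AddCommGroup M] [Module L M] {σ : K →+* L}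
    (f : X.cocycles →ₛₗ[σ] M) (hf : ∀ z ∈ X.coboundaries, f z = 0) : X.H0 →ₛₗ[σ] M :=
  X.coboundaries.liftQ f hf

lemma liftH0_toH0 {L M : Type*} [Ring L] [AddCommGroup M] [Module L M] {σ : K →+* L}
    (f : X.cocycles →ₛₗ[σ] M) (hf : ∀ z ∈ X.coboundaries, f z = 0) (z : X.cocycles) :
    X.liftH0 f hf (X.toH0 z) = f z := rfl

lemma coboundaries_mul_left (z : X.cocycles) {w : X.cocycles} (hw : w ∈ X.coboundaries) :
    z * w ∈ X.coboundaries := by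
  obtain ⟨b, hb, h⟩ := hw
  refine ⟨(z : S) * b, by simpa using X.mul_mem z.2.1 hb, ?_⟩
  rw [X.isDerivation.leibniz z.2.1, h, z.2.2]
  simp

lemma coboundaries_mul_right {z : X.cocycles} (hz : z ∈ X.coboundaries) (w : X.cocycles) :
    z * w ∈ X.coboundaries := by
  obtain ⟨b, hb, h⟩ := hz
  refine ⟨b * (w : S), by simpa using X.mul_mem hb w.2.1, ?_⟩
  rw [X.isDerivation.leibniz hb, h, w.2.2]
  simp

/-- The product on `H⁰`, induced by the product of cocycles. -/
instance : Mul X.H0 where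
  mul := Quotient.map₂ (· * ·) (by
    intro a a' ha b b' hb
    have ha := (Submodule.quotientRel_def _).1 ha
    have hb := (Submodule.quotientRel_def _).1 hb
    refine (Submodule.quotientRel_def _).2 ?_
    have : a * b - a' * b' = (a - a') * b + a' * (b - b') := by
      rw [sub_mul, mul_sub]; abel
    rw [this]
    exact add_mem (X.coboundaries_mul_right ha b) (X.coboundaries_mul_left a' hb))

lemma toH0_mul (z w : X.cocycles) : X.toH0 (z * w) = X.toH0 z * X.toH0 w := rfl

instance : NonUnitalRing X.H0 where
  left_distrib a b c := by
    obtain ⟨a, rfl⟩ := X.toH0_surjective a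
    obtain ⟨b, rfl⟩ := X.toH0_surjective b
    obtain ⟨c, rfl⟩ := X.toH0_surjective c
    simp only [← map_add, ← toH0_mul, mul_add]
  right_distrib a b c := by
    obtain ⟨a, rfl⟩ := X.toH0_surjective a
    obtain ⟨b, rfl⟩ := X.toH0_surjective b
    obtain ⟨c, rfl⟩ := X.toH0_surjective c
    simp only [← map_add, ← toH0_mul, add_mul]
  zero_mul a := by
    obtain ⟨a, rfl⟩ := X.toH0_surjective a
    rw [← map_zero X.toH0, ← toH0_mul, zero_mul]
  mul_zero a := by
    obtain ⟨a, rfl⟩ := X.toH0_surjective a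
    rw [← map_zero X.toH0, ← toH0_mul, mul_zero]
  mul_assoc a b c := by
    obtain ⟨a, rfl⟩ := X.toH0_surjective a
    obtain ⟨b, rfl⟩ := X.toH0_surjective b
    obtain ⟨c, rfl⟩ := X.toH0_surjective c
    simp only [← toH0_mul, mul_assoc]

instance : IsScalarTower K X.H0 X.H0 where
  smul_assoc r a b := by
    obtain ⟨a, rfl⟩ := X.toH0_surjective a
    obtain ⟨b, rfl⟩ := X.toH0_surjective b
    simp only [smul_eq_mul, ← map_smul, ← toH0_mul, smul_mul_assoc]

instance : SMulCommClass K X.H0 X.H0 where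
  smul_comm r a b := by
    obtain ⟨a, rfl⟩ := X.toH0_surjective a
    obtain ⟨b, rfl⟩ := X.toH0_surjective b
    simp only [smul_eq_mul, ← map_smul, ← toH0_mul, mul_smul_comm]

end DGAlgebraStr

end DG

/-! ## Free resolutions -/

section Resolution

variable {k : Type*} [Field k]

/-- The graded algebra `(R, gr)` is the free graded (non-unital) tensor algebra
`⨁_{n ≥ 1} W^{⊗ n}` on some graded subspace `W`: after adjoining a unit, the canonical map from
the tensor algebra of `W` is bijective. -/
def IsFreeGraded {R : Type*} [NonUnitalRing R] [Module k R] [IsScalarTower k R R]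
    [SMulCommClass k R R] (gr : ℤ → Submodule k R) : Prop :=
  ∃ W : Submodule k R, W = ⨆ i, W ⊓ gr i ∧
    Function.Bijective
      (TensorAlgebra.lift k (Unitization.inrHom k k R ∘ₗ W.subtype) :
        TensorAlgebra k W →ₐ[k] Unitization k R)

/-- A free non-positively graded DG algebra resolution `(R, s)` of the `k`-algebra `A`. -/
structure FreeResolution (k A R : Type*) [Field k]
    [NonUnitalRing A] [Module k A] [IsScalarTower k A A] [SMulCommClass k A A]
    [NonUnitalRing R] [Module k R] [IsScalarTower k R R] [SMulCommClass k R R]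
    extends DGAlgebraStr k R where
  nonpos : ∀ i : ℤ, 0 < i → gr i = ⊥
  free : IsFreeGraded gr
  acyclic : ∀ i : ℤ, i < 0 → ∀ a ∈ gr i, d a = 0 → ∃ b ∈ gr (i - 1), d b = a
  /-- the fixed isomorphism of algebras `H⁰(R, s) ≅ A` -/
  augmentation : toDGAlgebraStr.H0 →ₙₐ[k] A
  augmentation_bijective : Function.Bijective augmentation

end Resolution

/-! ## Artinian bases and reduction modulo the maximal ideal -/

/-- The local `k`-algebra `B` satisfies `B / 𝔪 = k`. -/
class HasResidueField (k B : Type*) [Field k] [CommRing B] [IsLocalRing B] [Algebra k B] :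
    Prop where
  bijective : Function.Bijective (algebraMap k (ResidueField B))

section Reduction

variable (k B : Type*) [Field k] [CommRing B] [IsLocalRing B] [Algebra k B] [HasResidueField k B]

/-- The identification `k = B / 𝔪`. -/
def residueEquiv : k ≃ₐ[k] ResidueField B :=
  AlgEquiv.ofBijective (Algebra.ofId k (ResidueField B)) HasResidueField.bijective

/-- The canonical map `B → B / 𝔪 = k`. -/
def residueMap : B →ₐ[k] k :=
  (residueEquiv k B).symm.toAlgHom.comp (IsScalarTower.toAlgHom k B (ResidueField B))

lemma residueEquiv_residueMap (b : B) :
    residueEquiv k B (residueMap k B b) = IsLocalRing.residue B b :=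
  (residueEquiv k B).apply_symm_apply _

variable {B} in
lemma residueMap_eq_zero_iff {b : B} : residueMap k B b = 0 ↔ b ∈ maximalIdeal B := by
  rw [← IsLocalRing.residue_eq_zero_iff, ← residueEquiv_residueMap k B b]
  simp

variable (M : Type*) [AddCommGroup M] [Module k M]

/-- The canonical map `M_B = B ⊗ M → k ⊗ M = M`. -/
def reduction : B ⊗[k] M →ₗ[k] M :=
  (TensorProduct.lid k M).toLinearMap ∘ₗ (residueMap k B).toLinearMap.rTensor M

variable {k B M}

@[simp] lemma reduction_tmul (b : B) (m : M) :
    reduction k B M (b ⊗ₜ m) = residueMap k B b • m := by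
  simp [reduction]

lemma reduction_smul (b : B) (x : B ⊗[k] M) :
    reduction k B M (b • x) = residueMap k B b • reduction k B M x := by
  induction x with
  | zero => simp
  | add x y hx hy => simp [hx, hy]
  | tmul c m => simp [TensorProduct.smul_tmul', mul_smul]

lemma sub_reduction_mem (x : B ⊗[k] M) :
    x - 1 ⊗ₜ reduction k B M x ∈ maximalIdeal B • (⊤ : Submodule B (B ⊗[k] M)) := by
  induction x with
  | zero => simp
  | add x y hx hy =>
    rw [map_add, TensorProduct.tmul_add, add_sub_add_comm]
    exact add_mem hx hy
  | tmul c m =>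
    have : c ⊗ₜ[k] m - 1 ⊗ₜ reduction k B M (c ⊗ₜ m) =
        (c - algebraMap k B (residueMap k B c)) • ((1 : B) ⊗ₜ[k] m) := by
      rw [reduction_tmul, TensorProduct.smul_tmul', TensorProduct.tmul_smul, smul_eq_mul, mul_one,
        TensorProduct.sub_tmul, TensorProduct.smul_tmul', Algebra.algebraMap_eq_smul_one]
    rw [this]
    refine Submodule.smul_mem_smul ?_ trivial
    rw [← residueMap_eq_zero_iff k]
    simp

lemma reduction_eq_zero_iff {x : B ⊗[k] M} :
    reduction k B M x = 0 ↔ x ∈ maximalIdeal B • (⊤ : Submodule B (B ⊗[k] M)) := by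
  constructor
  · intro h
    simpa [h] using sub_reduction_mem x
  · intro h
    induction h using Submodule.smul_induction_on' with
    | smul b hb y _ => rw [reduction_smul, (residueMap_eq_zero_iff k).2 hb, zero_smul]
    | add x _ y _ hx hy => rw [map_add, hx, hy, add_zero]

lemma reduction_baseChange {N : Type*} [AddCommGroup N] [Module k N] (f : M →ₗ[k] N)
    (x : B ⊗[k] M) : reduction k B N (f.baseChange B x) = f (reduction k B M x) := by
  induction x with
  | zero => simp
  | add x y hx hy => simp [hx, hy]
  | tmul c m => simp

lemma reduction_mem (p : Submodule k M) {x : B ⊗[k] M} (hx : x ∈ p.baseChange B) :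
    reduction k B M x ∈ p := by
  obtain ⟨y, hy⟩ := p.toBaseChange_surjective B ⟨x, hx⟩
  obtain rfl : p.subtype.baseChange B y = x := congrArg Subtype.val hy
  rw [reduction_baseChange]
  exact Subtype.prop _

lemma mem_smul_baseChange (p : Submodule k M) {x : B ⊗[k] M} (hx : x ∈ p.baseChange B)
    (h : reduction k B M x = 0) : x ∈ maximalIdeal B • p.baseChange B := by
  obtain ⟨y, hy⟩ := p.toBaseChange_surjective B ⟨x, hx⟩
  obtain rfl : p.subtype.baseChange B y = x := congrArg Subtype.val hy
  rw [reduction_baseChange] at h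
  have h0 : reduction k B p y = 0 := Subtype.ext h
  rw [reduction_eq_zero_iff] at h0
  have := Submodule.mem_map_of_mem (f := p.subtype.baseChange B) h0
  rw [Submodule.map_smul''] at this
  refine Submodule.smul_mono le_rfl ?_ this
  rintro _ ⟨w, -, rfl⟩
  exact (p.toBaseChange B w).2

lemma reduction_mul {R : Type*} [NonUnitalRing R] [Module k R] [IsScalarTower k R R]
    [SMulCommClass k R R] (x y : B ⊗[k] R) :
    reduction k B R (x * y) = reduction k B R x * reduction k B R y := by
  induction x with
  | zero => simp
  | add x x' hx hx' => simp [add_mul, hx, hx']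
  | tmul b r =>
    induction y with
    | zero => simp
    | add y y' hy hy' => rw [mul_add, map_add, hy, hy', map_add, mul_add]
    | tmul c r' =>
      rw [Algebra.TensorProduct.tmul_mul_tmul]
      rw [reduction_tmul, reduction_tmul, reduction_tmul, map_mul, smul_mul_assoc,
        mul_smul_comm, mul_smul]

end Reduction

/-! ## Flat deformations -/

section Flat

variable (k A B : Type u) [Field k]
  [NonUnitalRing A] [Module k A] [IsScalarTower k A A] [SMulCommClass k A A]
  [CommRing B] [IsLocalRing B] [Algebra k B]

/-- A flat deformation of `A` with basis `B`: a flat associative `B`-algebra `Ã`, together with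
a fixed isomorphism of `k`-algebras from `k ⊗_B Ã` (with `k = B / 𝔪`) to `A`. -/
structure FlatDeformation where
  carrier : Type u
  [ring : NonUnitalRing carrier]
  [module : Module B carrier]
  [isScalarTower : IsScalarTower B carrier carrier]
  [smulCommClass : SMulCommClass B carrier carrier]
  flat : Module.Flat B carrier
  fibre : (ResidueField B ⊗[B] carrier) →ₙₐ[k] A
  fibre_bijective : Function.Bijective fibre

attribute [instance] FlatDeformation.ring FlatDeformation.module FlatDeformation.isScalarTower
  FlatDeformation.smulCommClass

variable {k A B}

/-- The canonical map `Ã → A`. -/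
def FlatDeformation.toFibre (E : FlatDeformation k A B) (x : E.carrier) : A :=
  E.fibre (1 ⊗ₜ x)

/-- Equivalence of flat deformations: a `B`-algebra isomorphism over `A`. -/
def FlatDeformation.Equivalent (E₁ E₂ : FlatDeformation k A B) : Prop :=
  ∃ Φ : E₁.carrier →ₙₐ[B] E₂.carrier, Function.Bijective Φ ∧ ∀ x, E₂.toFibre (Φ x) = E₁.toFibre x

/-- The inverse of a bijective algebra homomorphism. -/
def NonUnitalAlgHom.inverseOfBijective {K S T : Type*} [CommRing K] [NonUnitalRing S]
    [NonUnitalRing T] [Module K S] [Module K T] (f : S →ₙₐ[K] T) (hf : Function.Bijective f) :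
    T →ₙₐ[K] S :=
  NonUnitalAlgHom.inverse f (Equiv.ofBijective f hf).symm
    (Equiv.ofBijective f hf).symm_apply_apply (Equiv.ofBijective f hf).apply_symm_apply

lemma NonUnitalAlgHom.apply_inverseOfBijective {K S T : Type*} [CommRing K] [NonUnitalRing S]
    [NonUnitalRing T] [Module K S] [Module K T] (f : S →ₙₐ[K] T) (hf : Function.Bijective f)
    (x : T) : f (f.inverseOfBijective hf x) = x :=
  (Equiv.ofBijective f hf).apply_symm_apply x

lemma NonUnitalAlgHom.inverseOfBijective_bijective {K S T : Type*} [CommRing K] [NonUnitalRing S]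
    [NonUnitalRing T] [Module K S] [Module K T] (f : S →ₙₐ[K] T) (hf : Function.Bijective f) :
    Function.Bijective (f.inverseOfBijective hf) :=
  (Equiv.ofBijective f hf).symm.bijective

variable (k A B) in
instance FlatDeformation.setoid : Setoid (FlatDeformation k A B) where
  r := FlatDeformation.Equivalent
  iseqv :=
    { refl := fun E => ⟨NonUnitalAlgHom.id B E.carrier, Function.bijective_id, fun _ => rfl⟩
      symm := by
        rintro E₁ E₂ ⟨Φ, hΦ, h⟩
        refine ⟨Φ.inverseOfBijective hΦ, Φ.inverseOfBijective_bijective hΦ, fun x => ?_⟩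
        rw [← h, Φ.apply_inverseOfBijective hΦ]
      trans := by
        rintro E₁ E₂ E₃ ⟨Φ, hΦ, h⟩ ⟨Ψ, hΨ, h'⟩
        exact ⟨Ψ.comp Φ, hΨ.comp hΦ, fun x => (h' _).trans (h x)⟩ }

variable (k A B) in
/-- `Def_♭(B)`: flat deformations of `A` with basis `B` modulo equivalence. -/
def DefFlat : Type (u + 1) := Quotient (FlatDeformation.setoid k A B)

end Flat

/-! ## Deformations of the relations -/

section Relations

variable {k A R B : Type u} [Field k]
  [NonUnitalRing A] [Module k A] [IsScalarTower k A A] [SMulCommClass k A A]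
  [NonUnitalRing R] [Module k R] [IsScalarTower k R R] [SMulCommClass k R R]
  [CommRing B] [IsLocalRing B] [Algebra k B]

/-- The grading of `R_B = B ⊗ R`. -/
def DGAlgebraStr.grB (X : DGAlgebraStr k R) (B : Type u) [CommRing B] [Algebra k B] (i : ℤ) :
    Submodule B (B ⊗[k] R) :=
  (X.gr i).baseChange B

lemma DGAlgebraStr.grB_induction (X : DGAlgebraStr k R) {i : ℤ} {p : B ⊗[k] R → Prop}
    (h0 : p 0) (hadd : ∀ x y, p x → p y → p (x + y)) (ht : ∀ b, ∀ a ∈ X.gr i, p (b ⊗ₜ a))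
    {x : B ⊗[k] R} (hx : x ∈ X.grB B i) : p x := by
  obtain ⟨y, hy⟩ := (X.gr i).toBaseChange_surjective B ⟨x, hx⟩
  obtain rfl : (X.gr i).subtype.baseChange B y = x := congrArg Subtype.val hy
  clear hy hx
  induction y with
  | zero => simpa using h0
  | add y z hy hz => rw [map_add]; exact hadd _ _ hy hz
  | tmul b a => exact ht b a a.2

lemma DGAlgebraStr.grB_mul_mem (X : DGAlgebraStr k R) {i j : ℤ} {x y : B ⊗[k] R}
    (hx : x ∈ X.grB B i) (hy : y ∈ X.grB B j) : x * y ∈ X.grB B (i + j) := by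
  refine X.grB_induction (p := fun x => x * y ∈ X.grB B (i + j)) (by simp)
    (fun x x' h h' => by rw [add_mul]; exact add_mem h h') (fun b a ha => ?_) hx
  refine X.grB_induction (p := fun y => (b ⊗ₜ a) * y ∈ X.grB B (i + j)) (by simp)
    (fun x x' h h' => by rw [mul_add]; exact add_mem h h') (fun c a' ha' => ?_) hy
  rw [Algebra.TensorProduct.tmul_mul_tmul]
  exact Submodule.tmul_mem_baseChange_of_mem _ (X.mul_mem ha ha')

lemma DGAlgebraStr.isGradedDerivation_baseChange (X : DGAlgebraStr k R) :
    IsGradedDerivation (X.grB B) 1 (X.d.baseChange B) where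
  map_mem {i a} ha := by
    refine X.grB_induction (p := fun x => X.d.baseChange B x ∈ X.grB B (i + 1)) (by simp)
      (fun x x' h h' => by rw [map_add]; exact add_mem h h') (fun b a ha => ?_) ha
    exact Submodule.tmul_mem_baseChange_of_mem _ (X.isDerivation.map_mem ha)
  leibniz {i a} ha y := by
    refine X.grB_induction (p := fun x => X.d.baseChange B (x * y) = X.d.baseChange B x * y +
      (1 * i).negOnePow • (x * X.d.baseChange B y)) (by simp)
      (fun x x' h h' => ?_) (fun b a ha => ?_) ha
    · rw [add_mul, map_add, h, h', map_add, add_mul, add_mul, smul_add]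
      abel
    · induction y with
      | zero => simp
      | add y z hy hz =>
        rw [mul_add, map_add, hy, hz, map_add, mul_add, mul_add, smul_add]
        abel
      | tmul c a' =>
        rw [Algebra.TensorProduct.tmul_mul_tmul, LinearMap.baseChange_tmul,
          X.isDerivation.leibniz ha, LinearMap.baseChange_tmul, LinearMap.baseChange_tmul,
          Algebra.TensorProduct.tmul_mul_tmul, Algebra.TensorProduct.tmul_mul_tmul,
          TensorProduct.tmul_add]
        congr 1
        rcases Int.even_or_odd (1 * i) with h | h
        · rw [Int.negOnePow_even _ h, one_smul, one_smul]
        · rw [Int.negOnePow_odd _ h, Units.neg_smul, Units.neg_smul, one_smul, one_smul,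
            TensorProduct.tmul_neg]

variable (B) in
/-- A deformation of the relations of `A` with basis `B`: a derivation `δ` of degree one of
the graded `B`-algebra `R_B` with image in `R ⊗ 𝔪` and `(s + δ)² = 0`. -/
structure RelDeformation (X : FreeResolution k A R) where
  δ : (B ⊗[k] R) →ₗ[B] (B ⊗[k] R)
  isDerivation : IsGradedDerivation (X.grB B) 1 δ
  range_le : LinearMap.range δ ≤ maximalIdeal B • (⊤ : Submodule B (B ⊗[k] R))
  sq_zero : ∀ x, (X.d.baseChange B + δ) ((X.d.baseChange B + δ) x) = 0

namespace RelDeformation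

variable {X : FreeResolution k A R}

/-- The DG algebra `(R_B, s + δ)`. -/
def perturbed (D : RelDeformation B X) : DGAlgebraStr B (B ⊗[k] R) where
  gr := X.grB B
  isInternal := X.isInternal.baseChange
  mul_mem := X.grB_mul_mem
  d := X.d.baseChange B + D.δ
  isDerivation :=
    { map_mem := fun ha =>
        add_mem (X.isGradedDerivation_baseChange.map_mem ha) (D.isDerivation.map_mem ha)
      leibniz := fun ha b => by
        simp only [LinearMap.add_apply, X.isGradedDerivation_baseChange.leibniz ha,
          D.isDerivation.leibniz ha, add_mul, mul_add, smul_add]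
        abel }
  d_d := D.sq_zero

variable [HasResidueField k B]

/-- Equivalence of deformations of the relations: a `B`-linear isomorphism of DG algebras
`(R_B, s + δ₁) → (R_B, s + δ₂)` over `R`. -/
def Equivalent (D₁ D₂ : RelDeformation B X) : Prop :=
  ∃ Φ : (B ⊗[k] R) →ₙₐ[B] (B ⊗[k] R), Function.Bijective Φ ∧
    (∀ i x, Φ x ∈ X.grB B i ↔ x ∈ X.grB B i) ∧
    (∀ x, Φ (D₁.perturbed.d x) = D₂.perturbed.d (Φ x)) ∧
    ∀ x, reduction k B R (Φ x) = reduction k B R x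

variable (B X) in
instance setoid : Setoid (RelDeformation B X) where
  r := Equivalent
  iseqv :=
    { refl := fun D => ⟨NonUnitalAlgHom.id B _, Function.bijective_id, fun _ _ => Iff.rfl,
        fun _ => rfl, fun _ => rfl⟩
      symm := by
        rintro D₁ D₂ ⟨Φ, hΦ, hgr, hd, hr⟩
        refine ⟨Φ.inverseOfBijective hΦ, Φ.inverseOfBijective_bijective hΦ, fun i x => ?_,
          fun x => ?_, fun x => ?_⟩
        · rw [← hgr, Φ.apply_inverseOfBijective hΦ]
        · apply hΦ.1
          rw [hd, Φ.apply_inverseOfBijective hΦ, Φ.apply_inverseOfBijective hΦ]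
        · rw [← hr, Φ.apply_inverseOfBijective hΦ]
      trans := by
        rintro D₁ D₂ D₃ ⟨Φ, hΦ, hgr, hd, hr⟩ ⟨Ψ, hΨ, hgr', hd', hr'⟩
        exact ⟨Ψ.comp Φ, hΨ.comp hΦ, fun i x => (hgr' _ _).trans (hgr _ _),
          fun x => (congrArg Ψ (hd x)).trans (hd' _), fun x => (hr' _).trans (hr _)⟩ }

end RelDeformation

variable (B) in
/-- `Def_rel(B)`: deformations of the relations with basis `B` modulo equivalence. -/
def DefRel [HasResidueField k B] (X : FreeResolution k A R) : Type u :=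
  Quotient (RelDeformation.setoid B X)

end Relations

/-! ## From deformations of the relations to flat deformations -/

section Fibre

variable {k A B M : Type u} [Field k]
  [NonUnitalRing A] [Module k A] [IsScalarTower k A A] [SMulCommClass k A A]
  [CommRing B] [IsLocalRing B] [Algebra k B] [HasResidueField k B]
  [NonUnitalRing M] [Module B M] [IsScalarTower B M M] [SMulCommClass B M M]

/-- The additive map `k ⊗_B M → A`, `c ⊗ x ↦ c • π x`, for `π` linear over `B → k`. -/
def fibreAddHom (π : M →ₛₗ[(residueMap k B : B →+* k)] A) : (ResidueField B ⊗[B] M) →+ A :=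
  TensorProduct.liftAddHom
    { toFun := fun c =>
        { toFun := fun x => (residueEquiv k B).symm c • π x
          map_zero' := by simp
          map_add' := by simp }
      map_zero' := by ext; simp
      map_add' := fun c c' => by ext; simp [add_smul] }
    (by
      intro b c x
      have h : (residueEquiv k B).symm (b • c) =
          residueMap k B b * (residueEquiv k B).symm c := by
        rw [Algebra.smul_def, map_mul]; rfl
      simp only [AddMonoidHom.coe_mk, ZeroHom.coe_mk]
      rw [h, LinearMap.map_smulₛₗ, mul_comm, mul_smul]
      rfl)

@[simp] lemma fibreAddHom_tmul (π : M →ₛₗ[(residueMap k B : B →+* k)] A) (c : ResidueField B)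
    (x : M) : fibreAddHom π (c ⊗ₜ x) = (residueEquiv k B).symm c • π x := rfl

/-- The `k`-algebra map `k ⊗_B M → A` induced by a multiplicative map `π : M → A` which is linear
over `B → k`. -/
def fibreAlgHom (π : M →ₛₗ[(residueMap k B : B →+* k)] A) (hπ : ∀ x y, π (x * y) = π x * π y) :
    (ResidueField B ⊗[B] M) →ₙₐ[k] A where
  toFun := fibreAddHom π
  map_zero' := map_zero _
  map_add' := map_add _
  map_smul' r x := by
    induction x with
    | zero => simp
    | add x y hx hy => simp only [smul_add, map_add, hx, hy]
    | tmul c x =>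
      rw [TensorProduct.smul_tmul', fibreAddHom_tmul, map_smul, smul_assoc]
      rfl
  map_mul' x y := by
    induction x with
    | zero => simp
    | add x x' hx hx' => simp only [add_mul, map_add, hx, hx']
    | tmul c x =>
      induction y with
      | zero => simp
      | add y y' hy hy' => simp only [mul_add, map_add, hy, hy']
      | tmul c' y =>
        rw [Algebra.TensorProduct.tmul_mul_tmul, fibreAddHom_tmul, fibreAddHom_tmul,
          fibreAddHom_tmul, hπ, map_mul, smul_mul_assoc, mul_smul_comm, mul_smul]

lemma fibreAlgHom_one_tmul (π : M →ₛₗ[(residueMap k B : B →+* k)] A)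
    (hπ : ∀ x y, π (x * y) = π x * π y) (x : M) : fibreAlgHom π hπ (1 ⊗ₜ x) = π x := by
  change fibreAddHom π (1 ⊗ₜ x) = π x
  simp

lemma exists_one_tmul (y : ResidueField B ⊗[B] M) : ∃ x : M, y = 1 ⊗ₜ x := by
  induction y with
  | zero => exact ⟨0, by simp⟩
  | add y z hy hz =>
    obtain ⟨a, rfl⟩ := hy
    obtain ⟨b, rfl⟩ := hz
    exact ⟨a + b, by rw [TensorProduct.tmul_add]⟩
  | tmul c x =>
    obtain ⟨b, rfl⟩ := IsLocalRing.residue_surjective c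
    refine ⟨b • x, ?_⟩
    rw [← TensorProduct.smul_tmul]
    congr 1
    rw [Algebra.smul_def, mul_one]
    rfl

lemma one_tmul_eq_zero {x : M} (hx : x ∈ maximalIdeal B • (⊤ : Submodule B M)) :
    (1 : ResidueField B) ⊗ₜ[B] x = 0 := by
  induction hx using Submodule.smul_induction_on' with
  | smul b hb y _ =>
    rw [← TensorProduct.smul_tmul, Algebra.smul_def, mul_one]
    rw [show algebraMap B (ResidueField B) b = 0 from (IsLocalRing.residue_eq_zero_iff b).2 hb,
      TensorProduct.zero_tmul]
  | add x _ y _ hx hy => rw [TensorProduct.tmul_add, hx, hy, add_zero]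

lemma fibreAlgHom_bijective (π : M →ₛₗ[(residueMap k B : B →+* k)] A)
    (hπ : ∀ x y, π (x * y) = π x * π y) (hsurj : Function.Surjective π)
    (hker : ∀ x, π x = 0 → x ∈ maximalIdeal B • (⊤ : Submodule B M)) :
    Function.Bijective (fibreAlgHom π hπ) := by
  constructor
  · rw [injective_iff_map_eq_zero]
    intro y hy
    obtain ⟨x, rfl⟩ := exists_one_tmul y
    rw [fibreAlgHom_one_tmul] at hy
    exact one_tmul_eq_zero (hker x hy)
  · intro a
    obtain ⟨x, rfl⟩ := hsurj a
    exact ⟨1 ⊗ₜ x, fibreAlgHom_one_tmul π hπ x⟩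

end Fibre

section NilpotentFacts

variable {B M : Type*} [CommRing B] [AddCommGroup M] [Module B M]

/-- Nakayama's lemma for a nilpotent ideal, without finiteness assumption. -/
lemma eq_top_of_sup_smul_eq_top {I : Ideal B} (hI : IsNilpotent I) (N : Submodule B M)
    (h : ∀ x : M, x ∈ N ⊔ I • (⊤ : Submodule B M)) : N = ⊤ := by
  obtain ⟨n, hn⟩ := hI
  have key : ∀ j : ℕ, (⊤ : Submodule B M) ≤ N ⊔ I ^ j • (⊤ : Submodule B M) := by
    intro j
    induction j with
    | zero => simp
    | succ j ih =>
      calc (⊤ : Submodule B M) ≤ N ⊔ I • (⊤ : Submodule B M) := fun x _ => h x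
        _ ≤ N ⊔ I • (N ⊔ I ^ j • (⊤ : Submodule B M)) :=
            sup_le_sup le_rfl (Submodule.smul_mono le_rfl ih)
        _ ≤ N ⊔ I ^ (j + 1) • (⊤ : Submodule B M) := by
            rw [Submodule.smul_sup, pow_succ', Submodule.mul_smul, ← sup_assoc]
            exact sup_le_sup (sup_le le_rfl Submodule.smul_le_right) le_rfl
  have := key n
  rw [hn] at this
  simpa using this

lemma map_mem_smul_top {N : Type*} [AddCommGroup N] [Module B N] (I : Ideal B)
    (f : M →ₗ[B] N) {x : M} (hx : x ∈ I • (⊤ : Submodule B M)) :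
    f x ∈ I • (⊤ : Submodule B N) := by
  have := Submodule.mem_map_of_mem (f := f) hx
  rw [Submodule.map_smul''] at this
  exact Submodule.smul_mono le_rfl le_top this

lemma map_mem_smul_top_of_range_le {I J : Ideal B}
    (f : M →ₗ[B] M) (hf : LinearMap.range f ≤ I • (⊤ : Submodule B M)) {x : M}
    (hx : x ∈ J • (⊤ : Submodule B M)) :
    f x ∈ (J * I) • (⊤ : Submodule B M) := by
  have := Submodule.mem_map_of_mem (f := f) hx
  rw [Submodule.map_smul'', Submodule.map_top] at this
  rw [Submodule.mul_smul]
  exact Submodule.smul_mono le_rfl hf this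

/-- Linear maps of vector spaces have generalized inverses. -/
lemma exists_generalized_inverse {k V W : Type*} [Field k] [AddCommGroup V] [Module k V]
    [AddCommGroup W] [Module k W] (f : V →ₗ[k] W) :
    ∃ g : W →ₗ[k] V, ∀ v, f (g (f v)) = f v := by
  obtain ⟨g, hg⟩ := f.rangeRestrict.exists_rightInverse_of_surjective
    (LinearMap.range_rangeRestrict f)
  obtain ⟨g', hg'⟩ := LinearMap.exists_extend g
  refine ⟨g', fun v => ?_⟩
  have h1 : g' (f v) = g (f.rangeRestrict v) := LinearMap.congr_fun hg' (f.rangeRestrict v)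
  rw [h1]
  exact congrArg Subtype.val (LinearMap.congr_fun hg (f.rangeRestrict v))

end NilpotentFacts

namespace RelDeformation

variable {k A R B : Type u} [Field k]
  [NonUnitalRing A] [Module k A] [IsScalarTower k A A] [SMulCommClass k A A]
  [NonUnitalRing R] [Module k R] [IsScalarTower k R R] [SMulCommClass k R R]
  [CommRing B] [IsLocalRing B] [Algebra k B] [HasResidueField k B]
  {X : FreeResolution k A R} (D : RelDeformation B X)

lemma mem_cocycles {x : B ⊗[k] R} (hx : x ∈ X.grB B 0) : x ∈ D.perturbed.cocycles := by
  refine ⟨hx, ?_⟩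
  have h : D.perturbed.d x ∈ X.grB B (0 + 1) := D.perturbed.isDerivation.map_mem hx
  have h0 : X.grB B (0 + 1) = ⊥ := by
    rw [DGAlgebraStr.grB, X.nonpos _ (by norm_num), Submodule.baseChange_bot]
  rwa [h0, Submodule.mem_bot] at h

lemma reduction_d (x : B ⊗[k] R) :
    reduction k B R (D.perturbed.d x) = X.d (reduction k B R x) := by
  change reduction k B R (X.d.baseChange B x + D.δ x) = _
  rw [map_add, reduction_baseChange, reduction_eq_zero_iff.2 (D.range_le ⟨x, rfl⟩), add_zero]

/-- Reduction of cocycles of degree zero modulo `𝔪`. -/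
def reductionCocycles : D.perturbed.cocycles →ₛₗ[(residueMap k B : B →+* k)] X.cocycles where
  toFun z := ⟨reduction k B R z, reduction_mem _ z.2.1, by
    rw [← D.reduction_d, z.2.2, map_zero]⟩
  map_add' _ _ := Subtype.ext (map_add _ _ _)
  map_smul' _ _ := Subtype.ext (reduction_smul _ _)

/-- The canonical map `H⁰(R_B, s + δ) → H⁰(R, s) ≅ A` induced by the reduction `R_B → R`. -/
def toFibre : D.perturbed.H0 →ₛₗ[(residueMap k B : B →+* k)] A :=
  D.perturbed.liftH0
    { toFun := fun z => X.augmentation (X.toH0 (D.reductionCocycles z))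
      map_add' := fun z w => by rw [map_add, map_add, map_add]
      map_smul' := fun b z => by
        rw [LinearMap.map_smulₛₗ, map_smul, map_smul] } (by
      rintro z ⟨b, hb, hz⟩
      have : X.toH0 (D.reductionCocycles z) = 0 :=
        X.toH0_eq_zero_iff.2 ⟨reduction k B R b, reduction_mem _ hb, by
          rw [← D.reduction_d, hz]; rfl⟩
      change X.augmentation (X.toH0 (D.reductionCocycles z)) = 0
      rw [this, map_zero])

lemma toFibre_toH0 (z : D.perturbed.cocycles) :
    D.toFibre (D.perturbed.toH0 z) = X.augmentation (X.toH0 (D.reductionCocycles z)) := rfl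

lemma toFibre_mul (x y : D.perturbed.H0) : D.toFibre (x * y) = D.toFibre x * D.toFibre y := by
  obtain ⟨z, rfl⟩ := D.perturbed.toH0_surjective x
  obtain ⟨w, rfl⟩ := D.perturbed.toH0_surjective y
  rw [← DGAlgebraStr.toH0_mul, toFibre_toH0, toFibre_toH0, toFibre_toH0, ← map_mul,
    ← DGAlgebraStr.toH0_mul]
  congr 2
  exact Subtype.ext (reduction_mul _ _)

lemma toFibre_surjective : Function.Surjective D.toFibre := by
  intro a
  obtain ⟨y, rfl⟩ := X.augmentation_bijective.2 a
  obtain ⟨z, rfl⟩ := X.toH0_surjective y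
  refine ⟨D.perturbed.toH0 ⟨1 ⊗ₜ (z : R),
    D.mem_cocycles (Submodule.tmul_mem_baseChange_of_mem _ z.2.1)⟩, ?_⟩
  rw [toFibre_toH0]
  congr 2
  exact Subtype.ext (by simp [reductionCocycles])

lemma toH0_mem_smul (x : D.perturbed.cocycles)
    (hx : (x : B ⊗[k] R) ∈ maximalIdeal B • X.grB B 0) :
    D.perturbed.toH0 x ∈ maximalIdeal B • (⊤ : Submodule B D.perturbed.H0) := by
  suffices h : ∀ y ∈ maximalIdeal B • X.grB B 0, ∀ hy : y ∈ D.perturbed.cocycles,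
      D.perturbed.toH0 ⟨y, hy⟩ ∈ maximalIdeal B • (⊤ : Submodule B D.perturbed.H0) from
    h x hx x.2
  intro y hy
  induction hy using Submodule.smul_induction_on' with
  | smul b hb y hy =>
    intro h
    have : D.perturbed.toH0 ⟨b • y, h⟩ = b • D.perturbed.toH0 ⟨y, D.mem_cocycles hy⟩ := by
      rw [← map_smul]; rfl
    rw [this]
    exact Submodule.smul_mem_smul hb trivial
  | add x hx y hy ihx ihy =>
    intro h
    have hx' := D.mem_cocycles (Submodule.smul_le_right hx)
    have hy' := D.mem_cocycles (Submodule.smul_le_right hy)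
    have : D.perturbed.toH0 ⟨x + y, h⟩ =
        D.perturbed.toH0 ⟨x, hx'⟩ + D.perturbed.toH0 ⟨y, hy'⟩ := by
      rw [← map_add]; rfl
    rw [this]
    exact add_mem (ihx hx') (ihy hy')

lemma mem_smul_of_toFibre_eq_zero (x : D.perturbed.H0) (hx : D.toFibre x = 0) :
    x ∈ maximalIdeal B • (⊤ : Submodule B D.perturbed.H0) := by
  obtain ⟨z, rfl⟩ := D.perturbed.toH0_surjective x
  rw [toFibre_toH0, ← map_zero X.augmentation] at hx
  obtain ⟨y, hy, hyz⟩ := X.toH0_eq_zero_iff.1 (X.augmentation_bijective.1 hx)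
  have hy1 : (1 : B) ⊗ₜ[k] y ∈ X.grB B (-1) := Submodule.tmul_mem_baseChange_of_mem _ hy
  have hd : D.perturbed.d (1 ⊗ₜ y) ∈ X.grB B (-1 + 1) := D.perturbed.isDerivation.map_mem hy1
  rw [neg_add_cancel] at hd
  obtain ⟨w, hw⟩ : ∃ w : D.perturbed.cocycles,
      (w : B ⊗[k] R) = (z : B ⊗[k] R) - D.perturbed.d (1 ⊗ₜ y) :=
    ⟨⟨_, D.mem_cocycles (sub_mem z.2.1 hd)⟩, rfl⟩
  have hzw : D.perturbed.toH0 z = D.perturbed.toH0 w :=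
    D.perturbed.toH0_eq_iff.2 ⟨1 ⊗ₜ y, hy1, by rw [hw, sub_sub_cancel]⟩
  have hw0 : reduction k B R (w : B ⊗[k] R) = 0 := by
    rw [hw, map_sub, reduction_d, reduction_tmul, map_one, one_smul, hyz]
    exact sub_self _
  have hw1 : (w : B ⊗[k] R) ∈ maximalIdeal B • X.grB B 0 :=
    mem_smul_baseChange (X.gr 0) w.2.1 hw0
  rw [hzw]
  exact D.toH0_mem_smul w hw1


/-- A `k`-linear section `A → R⁰` of the augmentation. -/
lemma exists_section (X : FreeResolution k A R) :
    ∃ σ : A →ₗ[k] X.cocycles, ∀ a, X.augmentation (X.toH0 (σ a)) = a := by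
  let p : X.cocycles →ₗ[k] A := (X.augmentation : X.H0 →ₗ[k] A) ∘ₗ X.toH0
  have hp : Function.Surjective p := X.augmentation_bijective.2.comp X.toH0_surjective
  obtain ⟨σ, hσ⟩ := p.exists_rightInverse_of_surjective (LinearMap.range_eq_top.2 hp)
  exact ⟨σ, fun a => LinearMap.congr_fun hσ a⟩

/-- A partial contraction in degree `-1`. -/
lemma exists_contraction (X : FreeResolution k A R) :
    ∃ α T : R →ₗ[k] R, ∀ y ∈ X.gr (-1), T y ∈ X.gr (-2) ∧ y = α (X.d y) + X.d (T y) := by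
  obtain ⟨g, hg⟩ := exists_generalized_inverse (X.d ∘ₗ (X.gr (-1)).subtype)
  obtain ⟨h, hh⟩ := exists_generalized_inverse (X.d ∘ₗ (X.gr (-2)).subtype)
  refine ⟨(X.gr (-1)).subtype ∘ₗ g,
    (X.gr (-2)).subtype ∘ₗ h ∘ₗ (LinearMap.id - (X.gr (-1)).subtype ∘ₗ g ∘ₗ X.d),
    fun y hy => ⟨(h _).2, ?_⟩⟩
  have h1 : X.d (y - (g (X.d y) : R)) = 0 := by
    rw [map_sub, sub_eq_zero]
    exact (hg ⟨y, hy⟩).symm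
  obtain ⟨w, hw, hwy⟩ := X.acyclic (-1) (by norm_num) _ (sub_mem hy (g (X.d y)).2) h1
  have h2 : X.d (h (y - (g (X.d y) : R)) : R) = y - (g (X.d y) : R) := by
    rw [← hwy]
    exact hh ⟨w, hw⟩
  change y = (g (X.d y) : R) + X.d (h (y - (g (X.d y) : R)) : R)
  rw [h2]
  abel

lemma baseChange_mem_grB {N : Type u} [AddCommGroup N] [Module k N] (i : ℤ) (f : N →ₗ[k] R)
    (hf : ∀ n, f n ∈ X.gr i) (u : B ⊗[k] N) : f.baseChange B u ∈ X.grB B i := by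
  induction u with
  | zero => simp
  | add u v hu hv => rw [map_add]; exact add_mem hu hv
  | tmul b n => exact Submodule.tmul_mem_baseChange_of_mem _ (hf n)

/-- If the boundary of an element of degree `-1` lies in `𝔪ⁿ R_B`, then it is the boundary of an
element of degree `-1` of `𝔪ⁿ R_B`. -/
lemma exists_small_primitive {x : B ⊗[k] R} (hx : x ∈ X.grB B (-1)) (n : ℕ)
    (hn : D.perturbed.d x ∈ maximalIdeal B ^ n • (⊤ : Submodule B (B ⊗[k] R))) :
    ∃ x' ∈ X.grB B (-1), x' ∈ maximalIdeal B ^ n • (⊤ : Submodule B (B ⊗[k] R)) ∧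
      D.perturbed.d x' = D.perturbed.d x := by
  obtain ⟨α, T, hαT⟩ := exists_contraction X
  suffices h : ∀ j ≤ n, ∃ x' ∈ X.grB B (-1),
      x' ∈ maximalIdeal B ^ j • (⊤ : Submodule B (B ⊗[k] R)) ∧
      D.perturbed.d x' = D.perturbed.d x from h n le_rfl
  intro j
  induction j with
  | zero => exact fun _ => ⟨x, hx, by simp, rfl⟩
  | succ j ih =>
    intro hj
    obtain ⟨y, hy, hyj, hyx⟩ := ih (by omega)
    have hT : ∀ z ∈ X.grB B (-1), T.baseChange B z ∈ X.grB B (-2) ∧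
        z = α.baseChange B (X.d.baseChange B z) + X.d.baseChange B (T.baseChange B z) := by
      intro z hz
      refine X.grB_induction (p := fun z => T.baseChange B z ∈ X.grB B (-2) ∧
        z = α.baseChange B (X.d.baseChange B z) + X.d.baseChange B (T.baseChange B z))
        (by simp) ?_ ?_ hz
      · rintro a b ⟨ha, ha'⟩ ⟨hb, hb'⟩
        refine ⟨by rw [map_add]; exact add_mem ha hb, ?_⟩
        conv_lhs => rw [ha', hb']
        simp only [map_add]
        abel
      · intro b a ha
        refine ⟨Submodule.tmul_mem_baseChange_of_mem _ (hαT a ha).1, ?_⟩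
        simp only [LinearMap.baseChange_tmul, ← TensorProduct.tmul_add]
        rw [← (hαT a ha).2]
    have hTy := (hT y hy).1
    have hdT : D.perturbed.d (T.baseChange B y) ∈ X.grB B (-2 + 1) :=
      D.perturbed.isDerivation.map_mem hTy
    rw [show (-2 : ℤ) + 1 = -1 by norm_num] at hdT
    refine ⟨y - D.perturbed.d (T.baseChange B y), sub_mem hy hdT, ?_, ?_⟩
    · have e : y - D.perturbed.d (T.baseChange B y) = α.baseChange B (D.perturbed.d y) -
          α.baseChange B (D.δ y) - D.δ (T.baseChange B y) := by
        have h1 : D.perturbed.d (T.baseChange B y) =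
          X.d.baseChange B (T.baseChange B y) + D.δ (T.baseChange B y) := rfl
        have h2 : D.perturbed.d y = X.d.baseChange B y + D.δ y := rfl
        have h3 := (hT y hy).2
        rw [h1, h2, map_add, add_sub_cancel_right, ← sub_sub]
        rw [eq_sub_of_add_eq h3.symm]
      have hle : maximalIdeal B ^ n • (⊤ : Submodule B (B ⊗[k] R)) ≤
          maximalIdeal B ^ (j + 1) • ⊤ :=
        Submodule.smul_mono (Ideal.pow_le_pow_right hj) le_rfl
      rw [e]
      refine sub_mem (sub_mem ?_ ?_) ?_
      · rw [hyx]
        exact map_mem_smul_top _ _ (hle hn)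
      · refine map_mem_smul_top _ _ ?_
        rw [pow_succ]
        exact map_mem_smul_top_of_range_le _ D.range_le hyj
      · rw [pow_succ]
        exact map_mem_smul_top_of_range_le _ D.range_le (map_mem_smul_top _ _ hyj)
    · rw [map_sub, D.perturbed.d_d, sub_zero, hyx]

/-- `H⁰(R_B, s + δ)` is flat over `B` (it is even isomorphic to `B ⊗ A` as a module). -/
lemma flat_H0 [IsArtinianRing B] : Module.Flat B D.perturbed.H0 := by
  have hnil : IsNilpotent (maximalIdeal B) := by
    have := IsArtinianRing.isNilpotent_jacobson_bot (R := B)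
    rwa [IsLocalRing.jacobson_eq_maximalIdeal ⊥ bot_ne_top] at this
  obtain ⟨σ, hσ⟩ := exists_section X
  let ι : A →ₗ[k] R :=
    { toFun := fun a => σ a
      map_add' := fun a b => by rw [map_add]; rfl
      map_smul' := fun c a => by rw [map_smul]; rfl }
  have hι : ∀ a, ι a ∈ X.gr 0 := fun a => (σ a).2.1
  let F : (B ⊗[k] A) →ₗ[B] D.perturbed.H0 := D.perturbed.toH0 ∘ₗ
    { toFun := fun u => ⟨ι.baseChange B u, D.mem_cocycles (baseChange_mem_grB 0 ι hι u)⟩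
      map_add' := fun u v => Subtype.ext (map_add _ _ _)
      map_smul' := fun b u => Subtype.ext (map_smul _ _ _) }
  have hF : ∀ a, D.toFibre (F (1 ⊗ₜ a)) = a := by
    intro a
    change X.augmentation (X.toH0 (D.reductionCocycles _)) = a
    conv_rhs => rw [← hσ a]
    congr 2
    refine Subtype.ext ?_
    change reduction k B R (ι.baseChange B (1 ⊗ₜ a)) = _
    rw [reduction_baseChange]
    simp [ι]
  have hsurj : Function.Surjective F := by
    rw [← LinearMap.range_eq_top]
    refine eq_top_of_sup_smul_eq_top hnil _ fun x => ?_
    have hx : x - F (1 ⊗ₜ D.toFibre x) ∈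
        maximalIdeal B • (⊤ : Submodule B D.perturbed.H0) :=
      D.mem_smul_of_toFibre_eq_zero _ (by rw [map_sub, hF, sub_self])
    rw [← add_sub_cancel (F (1 ⊗ₜ D.toFibre x)) x]
    exact Submodule.add_mem_sup ⟨_, rfl⟩ hx
  -- a linear extension of the map `R⁰ → A`
  obtain ⟨P, hP⟩ : ∃ P : R →ₗ[k] A, ∀ z : X.cocycles, P z = X.augmentation (X.toH0 z) := by
    let V : Submodule k R := X.cocycles.toSubmodule
    let p : V →ₗ[k] A :=
      { toFun := fun z => X.augmentation (X.toH0 ⟨z, z.2⟩)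
        map_add' := fun z w => by
          rw [← map_add, ← map_add]; rfl
        map_smul' := fun c z => by
          rw [RingHom.id_apply, ← map_smul, ← map_smul]; rfl }
    obtain ⟨P, hP⟩ := LinearMap.exists_extend p
    exact ⟨P, fun z => LinearMap.congr_fun hP ⟨z, z.2⟩⟩
  have hPι : P ∘ₗ ι = LinearMap.id := LinearMap.ext fun a => (hP (σ a)).trans (hσ a)
  have hPd : ∀ x ∈ X.grB B (-1), P.baseChange B (X.d.baseChange B x) = 0 := by
    intro x hx
    refine X.grB_induction (p := fun x => P.baseChange B (X.d.baseChange B x) = 0) (by simp)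
      (fun x y h h' => by rw [map_add, map_add, h, h', add_zero]) (fun b a ha => ?_) hx
    have hz : X.d a ∈ X.gr (-1 + 1) := X.isDerivation.map_mem ha
    rw [neg_add_cancel] at hz
    have h0 : X.toH0 ⟨X.d a, hz, X.d_d a⟩ = 0 := X.toH0_eq_zero_iff.2 ⟨a, ha, rfl⟩
    have := hP ⟨X.d a, hz, X.d_d a⟩
    rw [h0, map_zero] at this
    rw [LinearMap.baseChange_tmul, LinearMap.baseChange_tmul, this, TensorProduct.tmul_zero]
  have hinj : Function.Injective F := by
    rw [injective_iff_map_eq_zero]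
    intro u hu
    obtain ⟨x, hx, hxu⟩ := D.perturbed.toH0_eq_zero_iff.1 hu
    have hxu : D.perturbed.d x = ι.baseChange B u := hxu
    have hPιu : ∀ v, P.baseChange B (ι.baseChange B v) = v := by
      intro v
      rw [← LinearMap.comp_apply, ← LinearMap.baseChange_comp, hPι, LinearMap.baseChange_id]
      rfl
    have key : ∀ n : ℕ, u ∈ maximalIdeal B ^ n • (⊤ : Submodule B (B ⊗[k] A)) := by
      intro n
      induction n with
      | zero => simp
      | succ n ih =>
        have h1 : D.perturbed.d x ∈ maximalIdeal B ^ n • (⊤ : Submodule B (B ⊗[k] R)) := by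
          rw [hxu]
          exact map_mem_smul_top _ _ ih
        obtain ⟨y, hy, hyn, hyx⟩ := D.exists_small_primitive hx n h1
        have h2 : u = P.baseChange B (D.δ y) := by
          have h3 : X.d.baseChange B y + D.δ y = ι.baseChange B u := hyx.trans hxu
          rw [← hPιu u, ← h3, map_add, hPd y hy, zero_add]
        rw [h2, pow_succ]
        exact map_mem_smul_top _ _ (map_mem_smul_top_of_range_le _ D.range_le hyn)
    obtain ⟨n, hn⟩ := hnil
    have := key n
    rw [hn] at this
    simpa using this
  exact Module.Flat.of_linearEquiv (LinearEquiv.ofBijective F ⟨hinj, hsurj⟩).symm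

variable [IsArtinianRing B]

/-- The flat deformation `H⁰(R_B, s + δ)` of `A`; the isomorphism of its fibre with `A` is induced
by `R_B → R` and `H⁰(R, s) ≅ A`. -/
def toFlatDeformation : FlatDeformation k A B where
  carrier := D.perturbed.H0
  flat := D.flat_H0
  fibre := fibreAlgHom D.toFibre D.toFibre_mul
  fibre_bijective := fibreAlgHom_bijective _ _ D.toFibre_surjective D.mem_smul_of_toFibre_eq_zero

lemma toFlatDeformation_toFibre (x : D.perturbed.H0) :
    D.toFlatDeformation.toFibre x = D.toFibre x :=
  fibreAlgHom_one_tmul D.toFibre D.toFibre_mul x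

lemma Equivalent.toFlatDeformation {D₁ D₂ : RelDeformation B X} (h : Equivalent D₁ D₂) :
    D₁.toFlatDeformation.Equivalent D₂.toFlatDeformation := by
  obtain ⟨Φ, hΦ, hgr, hd, hr⟩ := h
  let f : D₁.perturbed.cocycles →ₗ[B] D₂.perturbed.cocycles :=
    { toFun := fun z => ⟨Φ z, (hgr 0 _).2 z.2.1, by rw [← hd, z.2.2, map_zero]⟩
      map_add' := fun z w => Subtype.ext (map_add Φ _ _)
      map_smul' := fun b z => Subtype.ext (map_smul Φ b _) }
  let F : D₁.perturbed.H0 →ₗ[B] D₂.perturbed.H0 :=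
    D₁.perturbed.liftH0 (D₂.perturbed.toH0 ∘ₗ f) (by
      rintro z ⟨b, hb, hz⟩
      exact D₂.perturbed.toH0_eq_zero_iff.2
        ⟨Φ b, (hgr _ _).2 hb, by rw [← hd, hz]; rfl⟩)
  have hF : ∀ z, F (D₁.perturbed.toH0 z) = D₂.perturbed.toH0 (f z) := fun _ => rfl
  have hmul : ∀ x y, F (x * y) = F x * F y := by
    intro x y
    obtain ⟨z, rfl⟩ := D₁.perturbed.toH0_surjective x
    obtain ⟨w, rfl⟩ := D₁.perturbed.toH0_surjective y
    rw [← DGAlgebraStr.toH0_mul, hF, hF, hF, ← DGAlgebraStr.toH0_mul]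
    congr 1
    exact Subtype.ext (map_mul Φ _ _)
  let G : D₁.perturbed.H0 →ₙₐ[B] D₂.perturbed.H0 :=
    { toFun := F
      map_smul' := fun b x => map_smul F b x
      map_zero' := map_zero F
      map_add' := map_add F
      map_mul' := hmul }
  refine ⟨G, ⟨?_, ?_⟩, ?_⟩
  · change Function.Injective F
    rw [injective_iff_map_eq_zero]
    intro x hx
    obtain ⟨z, rfl⟩ := D₁.perturbed.toH0_surjective x
    rw [hF] at hx
    obtain ⟨c, hc, hcz⟩ := D₂.perturbed.toH0_eq_zero_iff.1 hx
    obtain ⟨b, rfl⟩ := hΦ.2 c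
    refine D₁.perturbed.toH0_eq_zero_iff.2 ⟨b, (hgr _ _).1 hc, hΦ.1 ?_⟩
    rw [hd, hcz]
    rfl
  · change Function.Surjective F
    intro y
    obtain ⟨w, rfl⟩ := D₂.perturbed.toH0_surjective y
    obtain ⟨z, hz⟩ := hΦ.2 (w : B ⊗[k] R)
    have hz0 : z ∈ X.grB B 0 := (hgr 0 z).1 (by rw [hz]; exact w.2.1)
    refine ⟨D₁.perturbed.toH0 ⟨z, D₁.mem_cocycles hz0⟩, ?_⟩
    rw [hF]
    congr 1
    exact Subtype.ext hz
  · intro x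
    change D₂.toFlatDeformation.toFibre (F x) = D₁.toFlatDeformation.toFibre x
    refine (D₂.toFlatDeformation_toFibre _).trans
      (Eq.trans ?_ (D₁.toFlatDeformation_toFibre x).symm)
    obtain ⟨z, rfl⟩ := D₁.perturbed.toH0_surjective x
    rw [hF, toFibre_toH0, toFibre_toH0]
    congr 2
    exact Subtype.ext (hr _)

end RelDeformation

/-- The map `G(B) : Def_rel(B) → Def_♭(B)`, `δ ↦ H⁰(R_B, s + δ)`. -/
def relToFlat {k A R : Type u} [Field k]
    [NonUnitalRing A] [Module k A] [IsScalarTower k A A] [SMulCommClass k A A]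
    [NonUnitalRing R] [Module k R] [IsScalarTower k R R] [SMulCommClass k R R]
    (X : FreeResolution k A R)
    (B : Type u) [CommRing B] [IsLocalRing B] [IsArtinianRing B] [Algebra k B]
    [HasResidueField k B] : DefRel B X → DefFlat k A B :=
  Quotient.lift (s := RelDeformation.setoid B X)
    (fun D => Quotient.mk (FlatDeformation.setoid k A B) D.toFlatDeformation)
    fun _ _ h => Quotient.sound (RelDeformation.Equivalent.toFlatDeformation h)

end

/-!
# Every flat deformation comes from a deformation of the relations

Let `M` be a flat deformation of `A` with basis `B`. Since `R` is free, the augmentation `R → A`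
lifts to a multiplicative map `R_B → M` (`FreelyGenerates.exists_augmentation_lift`), and `M` is
isomorphic to `A_B` as a module, compatibly with the projections to `A`, because it is flat and
`𝔪` is nilpotent (`exists_linearEquiv_of_flat`). This gives `q : R_B → A_B`, whose kernel is an
ideal. It is enough to find a derivation `d` of `R_B` of degree one which lifts `s` and satisfies
`d² = 0` and `q d = 0`: the complex `⋯ → R_B⁻¹ → R_B⁰ → A_B → 0` then reduces modulo `𝔪` to an
exact complex of vector spaces, so it is itself exact, and `q` identifies `H⁰(R_B, d)` with `M`.

The derivation `d` is found by descending induction on the degree of the generators. Any values on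
homogeneous generators extend to a derivation (`FreelyGenerates.exists_isGradedDerivation`).
Suppose that `d² = 0` in degrees `≥ -n`, and let `w` be a generator of degree `-n - 1`. Then
`d² w` is a cocycle in `𝔪 R_B`, since `s² = 0`. The part of the complex in degrees `≥ -n` is exact
above its lowest degree, even after intersection with `𝔪 R_B` (`exists_primitive_of_exact`), so
`d² w = d x` with `x` in `𝔪 R_B`, and `d w` is replaced by `d w - x`. This changes `d` only
in degrees `< -n` (`IsComplexUpTo.exists_succ`). In degree `-1` the same argument is applied
to `q d w` (`exists_isComplexUpTo_one`). The process stabilizes in each degree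
(`exists_relDeformation`).
-/

/-! ### Free algebras without unit -/

section FreeAlgebra

variable {k R C : Type*} [Field k]
  [NonUnitalRing R] [Module k R] [IsScalarTower k R R] [SMulCommClass k R R]
  [NonUnitalRing C] [Module k C] [IsScalarTower k C C] [SMulCommClass k C C]

/-- The subspace `W` freely generates the algebra without unit `R`: after adjoining a unit to `R`,
the canonical map from the tensor algebra of `W` is bijective. -/
def FreelyGenerates (W : Submodule k R) : Prop :=
  Function.Bijective
    (TensorAlgebra.lift k (Unitization.inrHom k k R ∘ₗ W.subtype) :
      TensorAlgebra k W →ₐ[k] Unitization k R)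

namespace FreelyGenerates

variable {W : Submodule k R}

lemma hom_ext (hW : FreelyGenerates W) {f g : R →ₙₐ[k] C} (h : ∀ w ∈ W, f w = g w) : f = g := by
  let F (f : R →ₙₐ[k] C) : Unitization k R →ₐ[k] Unitization k C :=
    Unitization.lift ((Unitization.inrNonUnitalAlgHom k C).comp f)
  have hF : ∀ f r, F f (Unitization.inr r) = Unitization.inr (f r) := fun f r => by simp [F]
  have key : (F f).comp (TensorAlgebra.lift k (Unitization.inrHom k k R ∘ₗ W.subtype)) =
      (F g).comp (TensorAlgebra.lift k (Unitization.inrHom k k R ∘ₗ W.subtype)) := by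
    refine TensorAlgebra.hom_ext (LinearMap.ext fun w => ?_)
    simp [hF, h w w.2]
  ext r
  obtain ⟨t, ht⟩ := hW.2 (Unitization.inr r)
  have := DFunLike.congr_fun key t
  simp only [AlgHom.comp_apply, ht, hF] at this
  exact Unitization.inr_injective this

/-- The universal property of a free algebra without unit. -/
lemma exists_lift (hW : FreelyGenerates W) (g : W →ₗ[k] C) : ∃ f : R →ₙₐ[k] C, ∀ w : W, f w = g w := by
  let L := AlgEquiv.ofBijective _ hW
  let χ : Unitization k R →ₐ[k] Unitization k C :=
    (TensorAlgebra.lift k (Unitization.inrHom k k C ∘ₗ g)).comp L.symm.toAlgHom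
  have hL' : ∀ w : W, L (TensorAlgebra.ι k w) = Unitization.inr (w : R) := fun w => by
    change TensorAlgebra.lift k (Unitization.inrHom k k R ∘ₗ W.subtype) _ = _
    simp
  have hL : ∀ w : W, L.symm (Unitization.inr (w : R)) = TensorAlgebra.ι k w := fun w => by
    rw [AlgEquiv.symm_apply_eq, hL']
  have hχ : ∀ w : W, χ (Unitization.inr (w : R)) = Unitization.inr (g w) := fun w => by
    simp [χ, hL]
  -- `χ` preserves scalar parts, so it maps `R` to `C`
  have hfst : (Unitization.fstHom k C).comp χ = Unitization.fstHom k R := by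
    have : ((Unitization.fstHom k C).comp χ).comp L.toAlgHom =
        (Unitization.fstHom k R).comp L.toAlgHom := by
      refine TensorAlgebra.hom_ext (LinearMap.ext fun w => ?_)
      simp [χ, hL, hL']
    refine AlgHom.ext fun r => ?_
    have h := DFunLike.congr_fun this (L.symm r)
    simpa using h
  have hinr : ∀ r : R, χ (Unitization.inr r) = Unitization.inr (χ (Unitization.inr r)).snd := by
    intro r
    have h := DFunLike.congr_fun hfst (Unitization.inr r)
    ext
    · simpa using h
    · simp
  refine ⟨{ toFun := fun r => (χ (Unitization.inr r)).snd
            map_zero' := by simp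
            map_add' := fun a b => by simp
            map_smul' := fun c a => by simp
            map_mul' := fun a b => ?_ }, fun w => ?_⟩
  · rw [Unitization.inr_mul, map_mul, hinr a, hinr b, ← Unitization.inr_mul]
    simp
  · change (χ (Unitization.inr (w : R))).snd = g w
    rw [hχ]
    simp

/-- The inclusion of `W` into the subalgebra it generates extends to all of `R`, and the extension
is the identity. -/
lemma adjoin_eq_top (hW : FreelyGenerates W) : NonUnitalAlgebra.adjoin k (W : Set R) = ⊤ := by
  set N := NonUnitalAlgebra.adjoin k (W : Set R)
  obtain ⟨f, hf⟩ := hW.exists_lift (C := N)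
    { toFun := fun w => ⟨w, NonUnitalAlgebra.subset_adjoin k w.2⟩
      map_add' := fun _ _ => rfl
      map_smul' := fun _ _ => rfl }
  have h : (NonUnitalSubalgebraClass.subtype N).comp f = NonUnitalAlgHom.id k R :=
    hW.hom_ext fun w hw => by
      have := congrArg Subtype.val (hf ⟨w, hw⟩)
      exact this
  refine eq_top_iff.2 fun r _ => ?_
  have hr : (f r : R) = r := DFunLike.congr_fun h r
  rw [← hr]
  exact (f r).2

lemma induction (hW : FreelyGenerates W) {p : R → Prop} (hmem : ∀ w ∈ W, p w) (h0 : p 0)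
    (hadd : ∀ a b, p a → p b → p (a + b)) (hsmul : ∀ (c : k) a, p a → p (c • a))
    (hmul : ∀ a b, p a → p b → p (a * b)) (a : R) : p a := by
  have ha : a ∈ NonUnitalAlgebra.adjoin k (W : Set R) := by
    rw [hW.adjoin_eq_top]; trivial
  exact NonUnitalAlgebra.adjoin_induction (p := fun a _ => p a) hmem
    (fun a b _ _ => hadd a b) h0 (fun a b _ _ => hmul a b) (fun c a _ => hsmul c a) ha

/-- Induction over homogeneous elements: a property of pairs (degree, element) which is linear in
each degree, holds for homogeneous generators and is compatible with products of homogeneous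
elements holds for all homogeneous elements. -/
lemma homogeneous_induction (hW : FreelyGenerates W) {gr : ℤ → Submodule k R} (hgr : DirectSum.IsInternal gr)
    (hmul_mem : ∀ {i j : ℤ} {a b : R}, a ∈ gr i → b ∈ gr j → a * b ∈ gr (i + j))
    (hWgr : W = ⨆ i, W ⊓ gr i) {p : ℤ → R → Prop}
    (h0 : ∀ i, p i 0) (hadd : ∀ i a b, p i a → p i b → p i (a + b))
    (hsmul : ∀ i (c : k) a, p i a → p i (c • a))
    (hmem : ∀ i, ∀ w ∈ W, w ∈ gr i → p i w)
    (hmul : ∀ i j a b, a ∈ gr i → b ∈ gr j → p i a → p j b → p (i + j) (a * b))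
    {i : ℤ} {a : R} (ha : a ∈ gr i) : p i a := by
  let S : ℤ → Submodule k R := fun i =>
    { carrier := {a | a ∈ gr i ∧ p i a}
      add_mem' := fun {a b} ha hb => ⟨add_mem ha.1 hb.1, hadd i a b ha.2 hb.2⟩
      zero_mem' := ⟨zero_mem _, h0 i⟩
      smul_mem' := fun c a ha => ⟨Submodule.smul_mem _ c ha.1, hsmul i c a ha.2⟩ }
  have hS : ∀ i, S i ≤ gr i := fun i a ha => ha.1
  have htop : ∀ a, a ∈ ⨆ i, S i := by
    refine hW.induction ?_ (zero_mem _) (fun a b ha hb => add_mem ha hb)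
      (fun c a ha => Submodule.smul_mem _ c ha) ?_
    · intro w hw
      rw [hWgr] at hw
      refine (iSup_mono fun i => ?_ : ⨆ i, W ⊓ gr i ≤ ⨆ i, S i) hw
      rintro a ⟨ha, ha'⟩
      exact ⟨ha', hmem i a ha ha'⟩
    · intro a b ha hb
      induction ha using Submodule.iSup_induction' with
      | zero => simp
      | add x y _ _ hx hy => rw [add_mul]; exact add_mem hx hy
      | mem i a ha =>
        induction hb using Submodule.iSup_induction' with
        | zero => simp
        | add x y _ _ hx hy => rw [mul_add]; exact add_mem hx hy
        | mem j b hb =>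
          exact Submodule.mem_iSup_of_mem (i + j)
            ⟨hmul_mem ha.1 hb.1, hmul i j a b ha.1 hb.1 ha.2 hb.2⟩
  have hind : iSupIndep gr := hgr.submodule_iSupIndep
  -- compare the component of degree `i` with the sum of the other ones
  have hsup : a ∈ S i ⊔ ⨆ j ≠ i, S j := by
    have h := htop a
    rwa [iSup_split_single S i] at h
  obtain ⟨x, hx, y, hy, rfl⟩ := Submodule.mem_sup.1 hsup
  have hy' : y ∈ ⨆ j ≠ i, gr j := (iSup₂_mono fun j _ => hS j) hy
  have hyi : y ∈ gr i := by simpa using sub_mem ha (hS i hx)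
  have : y = 0 := (Submodule.disjoint_def.1 (hind i)) y hyi hy'
  rw [this, add_zero]
  exact hx.2

end FreelyGenerates

/-- A linear map on the sum of an internally graded module can be prescribed on each component. -/
lemma DirectSum.IsInternal.exists_linearMap {ι K M N : Type*} [DecidableEq ι] [CommRing K]
    [AddCommGroup M] [Module K M] [AddCommGroup N] [Module K N] {gr : ι → Submodule K M}
    (h : DirectSum.IsInternal gr) (f : ι → M →ₗ[K] N) :
    ∃ F : M →ₗ[K] N, ∀ i, ∀ x ∈ gr i, F x = f i x := by
  let e : (DirectSum ι fun i => gr i) ≃ₗ[K] M :=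
    LinearEquiv.ofBijective (DirectSum.coeLinearMap gr) h
  refine ⟨DirectSum.toModule K ι N (fun i => f i ∘ₗ (gr i).subtype) ∘ₗ e.symm.toLinearMap,
    fun i x hx => ?_⟩
  have : e.symm x = DirectSum.lof K ι (fun i => gr i) i ⟨x, hx⟩ := by
    rw [LinearEquiv.symm_apply_eq]
    exact (DirectSum.coeLinearMap_lof gr i ⟨x, hx⟩).symm
  simp [this]

lemma DirectSum.IsInternal.induction {ι K M : Type*} [DecidableEq ι] [CommRing K]
    [AddCommGroup M] [Module K M] {gr : ι → Submodule K M} (h : DirectSum.IsInternal gr)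
    {p : M → Prop} (hmem : ∀ i, ∀ x ∈ gr i, p x) (h0 : p 0)
    (hadd : ∀ x y, p x → p y → p (x + y)) (x : M) : p x := by
  have hx : x ∈ ⨆ i, gr i := by rw [h.submodule_iSup_eq_top]; trivial
  exact Submodule.iSup_induction gr (motive := p) hx hmem h0 hadd

end FreeAlgebra

/-! ### Derivations of free algebras -/

section Derivations

/-- A linear map on the generators of a free algebra extends to a derivation into an algebra `C`,
with values multiplied by `j b` on the right and by `j' a` on the left. It is the upper right
entry of the homomorphism to upper triangular `2 × 2` matrices with diagonal `(j', j)`. -/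
lemma FreelyGenerates.exists_twisted_derivation {k R C : Type*} [Field k]
    [NonUnitalRing R] [Module k R] [IsScalarTower k R R] [SMulCommClass k R R]
    [NonUnitalRing C] [Module k C] [IsScalarTower k C C] [SMulCommClass k C C]
    {W : Submodule k R} (hW : FreelyGenerates W) (j j' : R →ₙₐ[k] C) (θ : W →ₗ[k] C) :
    ∃ D : R →ₗ[k] C, (∀ w : W, D w = θ w) ∧ ∀ a b, D (a * b) = D a * j b + j' a * D b := by
  obtain ⟨Φ, hΦ⟩ := hW.exists_lift (C := Matrix (Fin 2) (Fin 2) C)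
    { toFun := fun w => !![j' w, θ w; 0, j w]
      map_add' := fun v w => by ext a b; fin_cases a <;> fin_cases b <;> simp
      map_smul' := fun c w => by ext a b; fin_cases a <;> fin_cases b <;> simp }
  have key : ∀ a, Φ a 0 0 = j' a ∧ Φ a 1 0 = 0 ∧ Φ a 1 1 = j a := by
    refine hW.induction ?_ ?_ ?_ ?_ ?_
    · intro w hw
      rw [hΦ ⟨w, hw⟩]
      simp
    · simp
    · rintro a b ⟨h1, h2, h3⟩ ⟨h1', h2', h3'⟩
      simp [h1, h2, h3, h1', h2', h3']
    · rintro c a ⟨h1, h2, h3⟩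
      simp [h1, h2, h3]
    · rintro a b ⟨h1, h2, h3⟩ ⟨h1', h2', h3'⟩
      simp [Matrix.mul_apply, h1, h2, h3, h1', h2', h3']
  refine ⟨{ toFun := fun a => Φ a 0 1
            map_add' := fun a b => by simp
            map_smul' := fun c a => by simp }, fun w => ?_, fun a b => ?_⟩
  · change Φ w 0 1 = θ w
    rw [hΦ]
    simp
  · change Φ (a * b) 0 1 = Φ a 0 1 * j b + j' a * Φ b 0 1
    rw [map_mul, Matrix.mul_apply, Fin.sum_univ_two, (key a).1, (key b).2.2, add_comm]

/-- The sign automorphism `a ↦ (-1)^{|a|} a` of a graded algebra. -/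
lemma exists_sign_automorphism {k R : Type*} [Field k]
    [NonUnitalRing R] [Module k R] [IsScalarTower k R R] [SMulCommClass k R R]
    {gr : ℤ → Submodule k R} (hgr : DirectSum.IsInternal gr)
    (hmul_mem : ∀ {i j : ℤ} {a b : R}, a ∈ gr i → b ∈ gr j → a * b ∈ gr (i + j)) :
    ∃ σ : R →ₙₐ[k] R, ∀ i, ∀ a ∈ gr i, σ a = i.negOnePow • a := by
  obtain ⟨σ, hσ⟩ := hgr.exists_linearMap fun i => i.negOnePow • (LinearMap.id : R →ₗ[k] R)
  have hσ' : ∀ i, ∀ a ∈ gr i, σ a = i.negOnePow • a := hσ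
  refine ⟨{ toFun := σ
            map_zero' := map_zero σ
            map_add' := map_add σ
            map_smul' := fun c a => map_smul σ c a
            map_mul' := fun a b => ?_ }, hσ'⟩
  refine hgr.induction (p := fun a => σ (a * b) = σ a * σ b) (fun i a ha => ?_) (by simp)
    (fun x y hx hy => by simp [add_mul, hx, hy]) a
  refine hgr.induction (p := fun b => σ (a * b) = σ a * σ b) (fun j b hb => ?_) (by simp)
    (fun x y hx hy => by simp [mul_add, hx, hy]) b
  rw [hσ' _ _ ha, hσ' _ _ hb, hσ' _ _ (hmul_mem ha hb), Int.negOnePow_add, smul_mul_assoc,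
    mul_smul_comm, mul_smul]

lemma IsGradedDerivation.add {K S : Type*} [CommRing K] [NonUnitalRing S] [Module K S]
    [IsScalarTower K S S] [SMulCommClass K S S] {gr : ℤ → Submodule K S} {n : ℤ}
    {d e : S →ₗ[K] S} (hd : IsGradedDerivation gr n d) (he : IsGradedDerivation gr n e) :
    IsGradedDerivation gr n (d + e) where
  map_mem ha := add_mem (hd.map_mem ha) (he.map_mem ha)
  leibniz ha b := by
    simp only [LinearMap.add_apply, hd.leibniz ha, he.leibniz ha, add_mul, mul_add, smul_add]
    abel

lemma IsGradedDerivation.sub {K S : Type*} [CommRing K] [NonUnitalRing S] [Module K S]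
    [IsScalarTower K S S] [SMulCommClass K S S] {gr : ℤ → Submodule K S} {n : ℤ}
    {d e : S →ₗ[K] S} (hd : IsGradedDerivation gr n d) (he : IsGradedDerivation gr n e) :
    IsGradedDerivation gr n (d - e) where
  map_mem ha := sub_mem (hd.map_mem ha) (he.map_mem ha)
  leibniz ha b := by
    simp only [LinearMap.sub_apply, hd.leibniz ha, he.leibniz ha, sub_mul, mul_sub, smul_sub]
    abel

/-- The square of a derivation of degree one obeys the Leibniz rule without signs. -/
lemma IsGradedDerivation.sq_mul {K S : Type*} [CommRing K] [NonUnitalRing S] [Module K S]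
    [IsScalarTower K S S] [SMulCommClass K S S] {gr : ℤ → Submodule K S}
    {d : S →ₗ[K] S} (hd : IsGradedDerivation gr 1 d) {i : ℤ} {a : S} (ha : a ∈ gr i) (b : S) :
    d (d (a * b)) = d (d a) * b + a * d (d b) := by
  have h : ∀ (ε : ℤˣ) (x : S), d (ε • x) = ε • d x := fun ε x => by
    rcases Int.units_eq_one_or ε with rfl | rfl <;> simp [Units.neg_smul]
  rw [hd.leibniz ha, map_add, h, hd.leibniz (hd.map_mem ha), hd.leibniz ha]
  simp only [one_mul, Int.negOnePow_succ, Units.neg_smul, smul_add, smul_smul,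
    Int.units_mul_self, one_smul]
  abel

variable {k R B : Type u} [Field k]
  [NonUnitalRing R] [Module k R] [IsScalarTower k R R] [SMulCommClass k R R]
  [CommRing B] [IsLocalRing B] [Algebra k B] {X : DGAlgebraStr k R} {W : Submodule k R}

lemma tmul_negOnePow_smul (i : ℤ) (b : B) (r : R) :
    b ⊗ₜ[k] (i.negOnePow • r) = i.negOnePow • (b ⊗ₜ[k] r) := by
  rcases Int.units_eq_one_or i.negOnePow with h | h <;>
    simp [h, Units.neg_smul, TensorProduct.tmul_neg]

/-- A linear map of degree one on homogeneous free generators of `R` extends to a `B`-linear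
derivation of degree one of `R_B`. -/
lemma FreelyGenerates.exists_isGradedDerivation (hW : FreelyGenerates W)
    (hWgr : W = ⨆ i, W ⊓ X.gr i) (θ : W →ₗ[k] B ⊗[k] R)
    (hθ : ∀ i, ∀ w : W, (w : R) ∈ X.gr i → θ w ∈ X.grB B (i + 1)) :
    ∃ D : (B ⊗[k] R) →ₗ[B] (B ⊗[k] R), IsGradedDerivation (X.grB B) 1 D ∧
      ∀ w : W, D (1 ⊗ₜ (w : R)) = θ w := by
  obtain ⟨σ, hσ⟩ := exists_sign_automorphism X.isInternal X.mul_mem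
  let j : R →ₙₐ[k] B ⊗[k] R :=
    { toFun := fun r => 1 ⊗ₜ r
      map_zero' := TensorProduct.tmul_zero _ _
      map_add' := TensorProduct.tmul_add _
      map_smul' := fun c r => by simp
      map_mul' := fun a b => by simp }
  obtain ⟨D, hDθ, hD⟩ := hW.exists_twisted_derivation j (j.comp σ) θ
  have hdeg : ∀ {i a}, a ∈ X.gr i → D a ∈ X.grB B (i + 1) := by
    refine hW.homogeneous_induction X.isInternal X.mul_mem hWgr
      (p := fun i a => D a ∈ X.grB B (i + 1)) (by simp) ?_ ?_ ?_ ?_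
    · intro i a b ha hb
      rw [map_add]
      exact add_mem ha hb
    · intro i c a ha
      rw [map_smul, ← algebraMap_smul B c (D a)]
      exact Submodule.smul_mem _ _ ha
    · intro i w hw hi
      rw [hDθ ⟨w, hw⟩]
      exact hθ i ⟨w, hw⟩ hi
    · intro i l a b ha hb hDa hDb
      rw [hD]
      refine add_mem ?_ ?_
      · rw [show i + l + 1 = (i + 1) + l by ring]
        exact X.grB_mul_mem hDa (Submodule.tmul_mem_baseChange_of_mem _ hb)
      · rw [show i + l + 1 = i + (l + 1) by ring]
        refine X.grB_mul_mem (Submodule.tmul_mem_baseChange_of_mem _ ?_) hDb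
        change σ a ∈ X.gr i
        rw [hσ _ _ ha]
        rcases Int.units_eq_one_or i.negOnePow with h | h <;> simpa [h, Units.neg_smul] using ha
  refine ⟨D.liftBaseChange B, ⟨fun {i a} ha => ?_, fun {i a} ha y => ?_⟩, fun w => ?_⟩
  · refine X.grB_induction (p := fun x => D.liftBaseChange B x ∈ X.grB B (i + 1)) (by simp)
      (fun x x' h h' => by rw [map_add]; exact add_mem h h') (fun b a ha => ?_) ha
    rw [LinearMap.liftBaseChange_tmul]
    exact Submodule.smul_mem _ _ (hdeg ha)
  · refine X.grB_induction (p := fun x => D.liftBaseChange B (x * y) =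
      D.liftBaseChange B x * y + (1 * i).negOnePow • (x * D.liftBaseChange B y)) (by simp)
      (fun x x' h h' => ?_) (fun b a ha => ?_) ha
    · rw [add_mul, map_add, h, h', map_add, add_mul, add_mul, smul_add]
      abel
    · induction y with
      | zero => simp
      | add y z hy hz =>
        rw [mul_add, map_add, hy, hz, map_add, mul_add, mul_add, smul_add]
        abel
      | tmul c a' =>
        have e : ∀ (b : B) (r : R), b ⊗ₜ[k] r = b • ((1 : B) ⊗ₜ[k] r) := fun b r => by
          rw [TensorProduct.smul_tmul', smul_eq_mul, mul_one]
        have h1 : D (a * a') = D a * 1 ⊗ₜ a' + i.negOnePow • (1 ⊗ₜ a * D a') := by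
          rw [hD]
          change D a * 1 ⊗ₜ a' + 1 ⊗ₜ σ a * D a' = _
          rw [hσ _ _ ha, tmul_negOnePow_smul, smul_mul_assoc]
        rw [Algebra.TensorProduct.tmul_mul_tmul, LinearMap.liftBaseChange_tmul, h1,
          LinearMap.liftBaseChange_tmul, LinearMap.liftBaseChange_tmul, e b a, e c a', one_mul]
        simp only [smul_mul_assoc, mul_smul_comm, smul_add, mul_smul]
        rw [smul_comm b c (D a * _)]
        congr 1
        rcases Int.units_eq_one_or i.negOnePow with h | h <;>
          simp [h, Units.neg_smul, smul_comm b c]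
  · rw [LinearMap.liftBaseChange_tmul, one_smul, hDθ]

end Derivations

/-! ### Exactness and freeness over a base with nilpotent maximal ideal -/

section Exactness

lemma isNilpotent_maximalIdeal (B : Type*) [CommRing B] [IsLocalRing B] [IsArtinianRing B] :
    IsNilpotent (maximalIdeal B) := by
  have := IsArtinianRing.isNilpotent_jacobson_bot (R := B)
  rwa [IsLocalRing.jacobson_eq_maximalIdeal ⊥ bot_ne_top] at this

lemma map_mem_mul_smul_top {B M N : Type*} [CommRing B] [AddCommGroup M] [Module B M]
    [AddCommGroup N] [Module B N] {I J : Ideal B} (f : M →ₗ[B] N)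
    (hf : ∀ x, f x ∈ I • (⊤ : Submodule B N)) {x : M} (hx : x ∈ J • (⊤ : Submodule B M)) :
    f x ∈ (J * I) • (⊤ : Submodule B N) := by
  have := Submodule.mem_map_of_mem (f := f) hx
  rw [Submodule.map_smul'', Submodule.map_top] at this
  rw [Submodule.mul_smul]
  refine Submodule.smul_mono le_rfl ?_ this
  rintro _ ⟨y, rfl⟩
  exact hf y

lemma mem_smul_top_of_one_tmul_eq_zero {B M : Type*} [CommRing B] [IsLocalRing B]
    [AddCommGroup M] [Module B M] {x : M} (hx : (1 : ResidueField B) ⊗ₜ[B] x = 0) :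
    x ∈ maximalIdeal B • (⊤ : Submodule B M) := by
  have h : (Ideal.Quotient.mk (maximalIdeal B) 1) ⊗ₜ[B] x = 0 := hx
  rw [← (TensorProduct.quotTensorEquivQuotSMul M (maximalIdeal B)).map_eq_zero_iff,
    TensorProduct.quotTensorEquivQuotSMul_mk_tmul, one_smul] at h
  exact (Submodule.Quotient.mk_eq_zero _).1 h

lemma Submodule.baseChange_induction {k B V : Type*} [CommRing k] [CommRing B] [Algebra k B]
    [AddCommGroup V] [Module k V] (U : Submodule k V) {p : B ⊗[k] V → Prop}
    (h0 : p 0) (hadd : ∀ x y, p x → p y → p (x + y)) (ht : ∀ b, ∀ v ∈ U, p (b ⊗ₜ v))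
    {x : B ⊗[k] V} (hx : x ∈ U.baseChange B) : p x := by
  obtain ⟨y, hy⟩ := U.toBaseChange_surjective B ⟨x, hx⟩
  obtain rfl : U.subtype.baseChange B y = x := congrArg Subtype.val hy
  clear hy hx
  induction y with
  | zero => simpa using h0
  | add y z hy hz => rw [map_add]; exact hadd _ _ hy hz
  | tmul b a => exact ht b a a.2

variable {k B : Type u} [Field k] [CommRing B] [IsLocalRing B] [Algebra k B] [HasResidueField k B]

lemma sub_baseChange_mem {V V' : Type u} [AddCommGroup V] [Module k V] [AddCommGroup V']
    [Module k V'] {f : V →ₗ[k] V'} {F : B ⊗[k] V →ₗ[B] B ⊗[k] V'}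
    (hF : ∀ x, reduction k B V' (F x) = f (reduction k B V x)) (x : B ⊗[k] V) :
    (f.baseChange B - F) x ∈ maximalIdeal B • (⊤ : Submodule B (B ⊗[k] V')) := by
  rw [← reduction_eq_zero_iff, LinearMap.sub_apply, map_sub, reduction_baseChange, hF, sub_self]

/-- Exactness is preserved by perturbation: let `F`, `G` be `B`-linear maps with `G ∘ F = 0` which
reduce modulo `𝔪` to maps `f : V₂ → V₁`, `g : V₁ → V₀` of `k`-vector spaces. If `U₂ → U₁ → V₀` is
exact for subspaces `U₂ ≤ V₂`, `U₁ ≤ V₁`, then so is `(U₂)_B → (U₁)_B → (V₀)_B`, and this holds on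
each step of the `𝔪`-adic filtration. A contraction of the unperturbed sequence corrects an error
in `𝔪ⁿ` up to an error in `𝔪ⁿ⁺¹`. -/
lemma exists_primitive_of_exact (hm : IsNilpotent (maximalIdeal B)) {V₂ V₁ V₀ : Type u}
    [AddCommGroup V₂] [Module k V₂] [AddCommGroup V₁] [Module k V₁] [AddCommGroup V₀] [Module k V₀]
    {f : V₂ →ₗ[k] V₁} {g : V₁ →ₗ[k] V₀} {U₂ : Submodule k V₂} {U₁ : Submodule k V₁}
    (hex : ∀ u ∈ U₁, g u = 0 → ∃ v ∈ U₂, f v = u)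
    {F : B ⊗[k] V₂ →ₗ[B] B ⊗[k] V₁} {G : B ⊗[k] V₁ →ₗ[B] B ⊗[k] V₀}
    (hF : ∀ x, reduction k B V₁ (F x) = f (reduction k B V₂ x))
    (hG : ∀ x, reduction k B V₀ (G x) = g (reduction k B V₁ x))
    (hFU : ∀ x ∈ U₂.baseChange B, F x ∈ U₁.baseChange B)
    (hGF : ∀ x ∈ U₂.baseChange B, G (F x) = 0) (n : ℕ) {y : B ⊗[k] V₁}
    (hy : y ∈ U₁.baseChange B) (hyn : y ∈ maximalIdeal B ^ n • (⊤ : Submodule B (B ⊗[k] V₁)))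
    (hGy : G y = 0) :
    ∃ x ∈ U₂.baseChange B, x ∈ maximalIdeal B ^ n • (⊤ : Submodule B (B ⊗[k] V₂)) ∧ F x = y := by
  obtain ⟨g', hg'⟩ := exists_generalized_inverse (g ∘ₗ U₁.subtype)
  obtain ⟨f', hf'⟩ := exists_generalized_inverse (f ∘ₗ U₂.subtype)
  let h₁ : V₀ →ₗ[k] V₁ := U₁.subtype ∘ₗ g'
  let h₂ : V₁ →ₗ[k] V₂ := U₂.subtype ∘ₗ f' ∘ₗ (LinearMap.id - h₁ ∘ₗ g)
  have hcontr : ∀ u ∈ U₁, u = h₁ (g u) + f (h₂ u) := by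
    intro u hu
    have hu' : g (u - h₁ (g u)) = 0 := by
      rw [map_sub, sub_eq_zero]
      exact (hg' ⟨u, hu⟩).symm
    obtain ⟨v, hv, hvu⟩ := hex _ (sub_mem hu (g' (g u)).2) hu'
    have hvu' : f v = u - h₁ (g u) := hvu
    have : f (h₂ u) = u - h₁ (g u) := by
      change f (f' (u - h₁ (g u)) : V₂) = u - h₁ (g u)
      rw [← hvu']
      exact hf' ⟨v, hv⟩
    rw [this]
    abel
  have hcontrB : ∀ y ∈ U₁.baseChange B, y = h₁.baseChange B (g.baseChange B y) +
      f.baseChange B (h₂.baseChange B y) := by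
    intro y hy
    refine U₁.baseChange_induction (p := fun y => y = h₁.baseChange B (g.baseChange B y) +
      f.baseChange B (h₂.baseChange B y)) (by simp) ?_ ?_ hy
    · intro x y hx hy
      conv_lhs => rw [hx, hy]
      simp only [map_add]
      abel
    · intro b v hv
      simp only [LinearMap.baseChange_tmul, ← TensorProduct.tmul_add]
      rw [← hcontr v hv]
  have hh₂ : ∀ y, h₂.baseChange B y ∈ U₂.baseChange B := by
    intro y
    induction y with
    | zero => simp
    | add u v hu hv => rw [map_add]; exact add_mem hu hv
    | tmul b v => exact Submodule.tmul_mem_baseChange_of_mem _ (f' _).2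
  obtain ⟨N, hN⟩ := hm
  suffices h : ∀ r n : ℕ, N ≤ n + r → ∀ y ∈ U₁.baseChange B,
      y ∈ maximalIdeal B ^ n • (⊤ : Submodule B (B ⊗[k] V₁)) → G y = 0 →
      ∃ x ∈ U₂.baseChange B, x ∈ maximalIdeal B ^ n • (⊤ : Submodule B (B ⊗[k] V₂)) ∧ F x = y from
    h N n (by omega) y hy hyn hGy
  intro r
  induction r with
  | zero =>
    intro n hn y hy hyn hGy
    have h0 : maximalIdeal B ^ n = ⊥ := le_bot_iff.1 ((Ideal.pow_le_pow_right hn).trans hN.le)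
    rw [h0, Submodule.bot_smul, Submodule.mem_bot] at hyn
    exact ⟨0, zero_mem _, zero_mem _, by rw [map_zero, hyn]⟩
  | succ r ih =>
    intro n hn y hy hyn hGy
    have hx₀ : h₂.baseChange B y ∈ maximalIdeal B ^ n • (⊤ : Submodule B (B ⊗[k] V₂)) :=
      map_mem_smul_top _ _ hyn
    have e : y - F (h₂.baseChange B y) = h₁.baseChange B ((g.baseChange B - G) y) +
        (f.baseChange B - F) (h₂.baseChange B y) := by
      rw [LinearMap.sub_apply, LinearMap.sub_apply, hGy, sub_zero, ← add_sub_assoc,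
        ← hcontrB y hy]
    have e₁ := map_mem_mul_smul_top (g.baseChange B - G) (sub_baseChange_mem hG) hyn
    have e₂ := map_mem_mul_smul_top (f.baseChange B - F) (sub_baseChange_mem hF) hx₀
    rw [← pow_succ] at e₁ e₂
    have e₃ := map_mem_smul_top _ (h₁.baseChange B) e₁
    obtain ⟨x, hx, hxn, hxy⟩ := ih (n + 1) (by omega) (y - F (h₂.baseChange B y))
      (sub_mem hy (hFU _ (hh₂ y))) (by rw [e]; exact add_mem e₃ e₂)
      (by rw [map_sub, hGy, hGF _ (hh₂ y), sub_zero])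
    refine ⟨h₂.baseChange B y + x, add_mem (hh₂ y) hx, add_mem hx₀ ?_, ?_⟩
    · exact Submodule.smul_mono (Ideal.pow_le_pow_right n.le_succ) le_rfl hxn
    · rw [map_add, hxy]
      abel

/-- A flat module `M` over a local ring with nilpotent maximal ideal is free; more precisely, an
identification of `M / 𝔪 M` with a vector space `A` lifts to an isomorphism `A_B ≃ M`. -/
lemma exists_linearEquiv_of_flat (hm : IsNilpotent (maximalIdeal B)) {A M : Type u}
    [AddCommGroup A] [Module k A] [AddCommGroup M] [Module B M] [Module.Flat B M]
    (π : M →ₛₗ[(residueMap k B : B →+* k)] A) (hsurj : Function.Surjective π)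
    (hker : ∀ x, π x = 0 → x ∈ maximalIdeal B • (⊤ : Submodule B M)) :
    ∃ e : M ≃ₗ[B] B ⊗[k] A, ∀ x, reduction k B A (e x) = π x := by
  let a := Module.Basis.ofVectorSpace k A
  choose v hv using fun i => hsurj (a i)
  have hπm : ∀ x ∈ maximalIdeal B • (⊤ : Submodule B M), π x = 0 := by
    intro x hx
    induction hx using Submodule.smul_induction_on' with
    | smul b hb y _ => rw [LinearMap.map_smulₛₗ]; simp [(residueMap_eq_zero_iff k).2 hb]
    | add x _ y _ hx hy => rw [map_add, hx, hy, add_zero]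
  -- by flatness, linear independence of `v` can be checked modulo `𝔪`
  have hli : LinearIndependent B v := by
    refine Module.IsLocalRing.linearIndependent_of_flat v ?_
    rw [linearIndependent_iff']
    intro s c hc i hi
    choose b hb using fun i => IsLocalRing.residue_surjective (c i)
    have h1 : (1 : ResidueField B) ⊗ₜ[B] (∑ i ∈ s, b i • v i) = 0 := by
      rw [TensorProduct.tmul_sum, ← hc]
      refine Finset.sum_congr rfl fun i _ => ?_
      rw [← hb, TensorProduct.tmul_smul]
      rfl
    have h3 := hπm _ (mem_smul_top_of_one_tmul_eq_zero h1)
    rw [map_sum] at h3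
    have h4 : ∑ i ∈ s, residueMap k B (b i) • a i = 0 := by
      rw [← h3]
      exact Finset.sum_congr rfl fun i _ => by rw [LinearMap.map_smulₛₗ, hv]; rfl
    have h5 := linearIndependent_iff'.1 a.linearIndependent s _ h4 i hi
    rw [← hb i, IsLocalRing.residue_eq_zero_iff]
    exact (residueMap_eq_zero_iff k).1 h5
  have hspan : Submodule.span B (Set.range v) = ⊤ := by
    refine eq_top_of_sup_smul_eq_top hm _ fun x => ?_
    obtain ⟨c, hc⟩ : ∃ c : _ →₀ k, Finsupp.linearCombination k a c = π x :=
      ⟨a.repr (π x), a.linearCombination_repr _⟩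
    let y : M := c.sum fun i r => algebraMap k B r • v i
    have hy : y ∈ Submodule.span B (Set.range v) :=
      Submodule.sum_mem _ fun i _ => Submodule.smul_mem _ _ (Submodule.subset_span ⟨i, rfl⟩)
    have hxy : π (x - y) = 0 := by
      rw [map_sub, ← hc, sub_eq_zero, Finsupp.linearCombination_apply, map_finsuppSum]
      refine Finset.sum_congr rfl fun i _ => ?_
      simp only [LinearMap.map_smulₛₗ, hv]
      simp
    rw [← add_sub_cancel y x]
    exact Submodule.add_mem_sup hy (hker _ hxy)
  -- `e` maps the basis `v` to the basis `1 ⊗ a`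
  let e := (Module.Basis.mk hli hspan.ge).equiv (a.baseChange B) (Equiv.refl _)
  have he : ∀ i, e (v i) = 1 ⊗ₜ a i := fun i => by
    have := (Module.Basis.mk hli hspan.ge).equiv_apply i (a.baseChange B) (Equiv.refl _)
    simpa [e] using this
  refine ⟨e, fun x => ?_⟩
  have hx : x ∈ Submodule.span B (Set.range v) := by rw [hspan]; trivial
  induction hx using Submodule.span_induction with
  | mem x hx =>
    obtain ⟨i, rfl⟩ := hx
    rw [he, reduction_tmul, map_one, one_smul, hv]
  | zero => simp
  | add x y _ _ hx hy => simp only [map_add, hx, hy]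
  | smul b x _ hx =>
    rw [map_smul, reduction_smul, hx, LinearMap.map_smulₛₗ]
    rfl

end Exactness

/-! ### The augmentation of a free resolution and its lifts -/

section Augmentation

variable {k A R B M : Type u} [Field k]
  [NonUnitalRing A] [Module k A] [IsScalarTower k A A] [SMulCommClass k A A]
  [NonUnitalRing R] [Module k R] [IsScalarTower k R R] [SMulCommClass k R R]
  [CommRing B] [IsLocalRing B] [Algebra k B] [HasResidueField k B]
  {X : FreeResolution k A R}

lemma FreeResolution.grB_eq_zero (X : FreeResolution k A R) {i : ℤ} (hi : 0 < i) {x : B ⊗[k] R}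
    (hx : x ∈ X.grB B i) : x = 0 := by
  rwa [DGAlgebraStr.grB, X.nonpos i hi, Submodule.baseChange_bot, Submodule.mem_bot] at hx

lemma FreeResolution.mem_cocycles (X : FreeResolution k A R) {a : R} (ha : a ∈ X.gr 0) :
    a ∈ X.cocycles := by
  refine ⟨ha, ?_⟩
  have h : X.d a ∈ X.gr (0 + 1) := X.isDerivation.map_mem ha
  rwa [X.nonpos _ (by norm_num), Submodule.mem_bot] at h

/-- The augmentation `R → H⁰(R, s) ≅ A`, extended by zero to negative degrees. It is
multiplicative because products with a factor of negative degree have negative degree. -/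
lemma FreeResolution.exists_augmentation (X : FreeResolution k A R) :
    ∃ ε : R →ₙₐ[k] A, ∀ z : X.cocycles, ε z = X.augmentation (X.toH0 z) := by
  let V : Submodule k R := X.cocycles.toSubmodule
  let p : V →ₗ[k] A :=
    { toFun := fun z => X.augmentation (X.toH0 ⟨z, z.2⟩)
      map_add' := fun z w => by
        rw [← map_add, ← map_add]; rfl
      map_smul' := fun c z => by
        rw [RingHom.id_apply, ← map_smul, ← map_smul]; rfl }
  obtain ⟨P, hP⟩ := LinearMap.exists_extend p
  have hP' : ∀ z : X.cocycles, P z = X.augmentation (X.toH0 z) :=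
    fun z => LinearMap.congr_fun hP ⟨z, z.2⟩
  obtain ⟨ε, hε⟩ := X.isInternal.exists_linearMap fun i => if i = 0 then P else 0
  have hε0 : ∀ z : X.cocycles, ε z = X.augmentation (X.toH0 z) := fun z => by
    rw [hε 0 z z.2.1, if_pos rfl, hP']
  have hεi : ∀ i ≠ 0, ∀ a ∈ X.gr i, ε a = 0 := fun i hi a ha => by
    rw [hε i a ha, if_neg hi, LinearMap.zero_apply]
  have hmul : ∀ a b, ε (a * b) = ε a * ε b := by
    intro a b
    refine X.isInternal.induction (p := fun a => ε (a * b) = ε a * ε b) (fun i a ha => ?_)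
      (by simp) (fun x y hx hy => by simp [add_mul, hx, hy]) a
    refine X.isInternal.induction (p := fun b => ε (a * b) = ε a * ε b) (fun j b hb => ?_)
      (by simp) (fun x y hx hy => by simp [mul_add, hx, hy]) b
    have hzero : ∀ i, 0 < i → ∀ a ∈ X.gr i, a = 0 := fun i hi a ha => by
      rwa [X.nonpos i hi, Submodule.mem_bot] at ha
    rcases lt_or_ge 0 i with hi | hi
    · simp [hzero i hi a ha]
    rcases lt_or_ge 0 j with hj | hj
    · simp [hzero j hj b hb]
    rcases eq_or_ne i 0 with rfl | hi'
    · rcases eq_or_ne j 0 with rfl | hj'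
      · have ha' := X.mem_cocycles ha
        have hb' := X.mem_cocycles hb
        rw [hε0 ⟨a, ha'⟩, hε0 ⟨b, hb'⟩, ← map_mul, ← DGAlgebraStr.toH0_mul]
        exact hε0 (⟨a, ha'⟩ * ⟨b, hb'⟩)
      · rw [hεi j hj' b hb, hεi _ (by omega) _ (X.mul_mem ha hb), mul_zero]
    · rw [hεi i hi' a ha, hεi _ (by omega) _ (X.mul_mem ha hb), zero_mul]
  exact ⟨{ toFun := ε
           map_zero' := map_zero ε
           map_add' := map_add ε
           map_smul' := fun c a => map_smul ε c a
           map_mul' := hmul }, hε0⟩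

/-- The augmentation `R → A` lifts to a multiplicative map `R_B → M` for every `B`-algebra `M`
over `A`, because `R` is free. -/
lemma FreelyGenerates.exists_augmentation_lift {W : Submodule k R} (hW : FreelyGenerates W)
    (ε : R →ₙₐ[k] A)
    [NonUnitalRing M] [Module B M] [IsScalarTower B M M] [SMulCommClass B M M]
    (π : M →ₛₗ[(residueMap k B : B →+* k)] A) (hsurj : Function.Surjective π)
    (hmul : ∀ x y, π (x * y) = π x * π y) :
    ∃ q : (B ⊗[k] R) →ₗ[B] M, (∀ x y, q (x * y) = q x * q y) ∧
      ∀ x, π (q x) = ε (reduction k B R x) := by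
  let _ : Module k M := Module.compHom M (algebraMap k B)
  have hsmul : ∀ (c : k) (x : M), c • x = algebraMap k B c • x := fun _ _ => rfl
  have : IsScalarTower k B M := ⟨fun c b x => by rw [hsmul, smul_smul, Algebra.smul_def]⟩
  have : IsScalarTower k M M := ⟨fun c x y => by simp only [hsmul, smul_assoc]⟩
  have : SMulCommClass k M M := ⟨fun c x y => by simp only [hsmul, smul_comm]⟩
  have hπk : ∀ (c : k) (x : M), π (c • x) = c • π x := fun c x => by
    rw [hsmul, LinearMap.map_smulₛₗ]
    simp
  let πk : M →ₗ[k] A :=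
    { toFun := π
      map_add' := map_add π
      map_smul' := hπk }
  obtain ⟨ς, hς⟩ := πk.exists_rightInverse_of_surjective (LinearMap.range_eq_top.2 hsurj)
  have hς' : ∀ a, π (ς a) = a := fun a => LinearMap.congr_fun hς a
  obtain ⟨p, hp⟩ := hW.exists_lift (ς ∘ₗ (ε : R →ₗ[k] A) ∘ₗ W.subtype)
  have hpε : ∀ a, π (p a) = ε a := by
    refine hW.induction ?_ (by simp) (fun a b ha hb => by simp [ha, hb])
      (fun c a ha => by rw [map_smul p, hπk, ha, map_smul])
      (fun a b ha hb => by rw [map_mul p, hmul, ha, hb, map_mul])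
    intro w hw
    rw [hp ⟨w, hw⟩]
    exact hς' _
  let q : (B ⊗[k] R) →ₗ[B] M := (p : R →ₗ[k] M).liftBaseChange B
  have hq : ∀ b r, q (b ⊗ₜ r) = b • p r := fun _ _ => rfl
  refine ⟨q, fun x y => ?_, fun x => ?_⟩
  · induction x with
    | zero => simp
    | add x x' hx hx' => rw [add_mul, map_add, hx, hx', map_add, add_mul]
    | tmul b r =>
      induction y with
      | zero => simp
      | add y y' hy hy' => rw [mul_add, map_add, hy, hy', map_add, mul_add]
      | tmul c r' =>
        rw [Algebra.TensorProduct.tmul_mul_tmul, hq, hq, hq, map_mul, smul_mul_assoc,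
          mul_smul_comm, mul_smul]
  · induction x with
    | zero => simp
    | add x y hx hy => simp only [map_add, hx, hy]
    | tmul b r =>
      rw [hq, LinearMap.map_smulₛₗ, hpε, reduction_tmul, map_smul]
      rfl

end Augmentation

/-! ### Construction of the perturbed differential -/

section Perturbation

variable {k R B : Type u} [Field k]
  [NonUnitalRing R] [Module k R] [IsScalarTower k R R] [SMulCommClass k R R]
  [CommRing B] [IsLocalRing B] [Algebra k B] [HasResidueField k B]

/-- A derivation of degree one of `R_B` which reduces to the differential of `R` modulo `𝔪`; its
square need not vanish. -/
structure DGAlgebraStr.IsPerturbation (X : DGAlgebraStr k R)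
    (d : (B ⊗[k] R) →ₗ[B] (B ⊗[k] R)) : Prop where
  isDerivation : IsGradedDerivation (X.grB B) 1 d
  reduction_eq : ∀ x, reduction k B R (d x) = X.d (reduction k B R x)

lemma reduction_negOnePow_smul (i : ℤ) (x : B ⊗[k] R) :
    reduction k B R (i.negOnePow • x) = i.negOnePow • reduction k B R x := by
  rcases Int.units_eq_one_or i.negOnePow with h | h <;> simp [h, Units.neg_smul]

lemma DGAlgebraStr.eq_zero_of_mem_grB (X : DGAlgebraStr k R) {V : Type u} [AddCommGroup V]
    [Module B V] {i : ℤ} (f : (B ⊗[k] R) →ₗ[B] V) (h : ∀ a ∈ X.gr i, f (1 ⊗ₜ a) = 0)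
    {x : B ⊗[k] R} (hx : x ∈ X.grB B i) : f x = 0 := by
  refine X.grB_induction (p := fun x => f x = 0) (by simp)
    (fun x y hx hy => by rw [map_add, hx, hy, add_zero]) (fun b a ha => ?_) hx
  have : b ⊗ₜ[k] a = b • ((1 : B) ⊗ₜ[k] a) := by
    rw [TensorProduct.smul_tmul', smul_eq_mul, mul_one]
  rw [this, map_smul, h a ha, smul_zero]

variable {X : DGAlgebraStr k R} {W : Submodule k R}

/-- Modification of a perturbation `d` on the generators of a single degree `e`, so that there
`q ∘ d` vanishes for a given linear map `q`. This is possible as soon as the values of `q ∘ d` on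
these generators are values of `q` on `𝔪 R_B`. -/
lemma DGAlgebraStr.IsPerturbation.exists_modification {d : (B ⊗[k] R) →ₗ[B] (B ⊗[k] R)}
    (hd : X.IsPerturbation d) (hX : ∀ i : ℤ, 0 < i → X.gr i = ⊥) (hW : FreelyGenerates W)
    (hWgr : W = ⨆ i, W ⊓ X.gr i) {V : Type u} [AddCommGroup V] [Module k V]
    (q : (B ⊗[k] R) →ₗ[B] B ⊗[k] V) (e : ℤ)
    (hq : ∀ w ∈ W, w ∈ X.gr e → ∃ x ∈ X.grB B (e + 1),
      x ∈ maximalIdeal B • (⊤ : Submodule B (B ⊗[k] R)) ∧ q x = q (d (1 ⊗ₜ w))) :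
    ∃ d' : (B ⊗[k] R) →ₗ[B] (B ⊗[k] R), X.IsPerturbation d' ∧
      (∀ i, e < i → ∀ x ∈ X.grB B i, d' x = d x) ∧
      ∀ w ∈ W, w ∈ X.gr e → q (d' (1 ⊗ₜ w)) = 0 := by
  let N : Submodule k (B ⊗[k] R) := (X.grB B (e + 1) ⊓
    maximalIdeal B • (⊤ : Submodule B (B ⊗[k] R))).restrictScalars k
  let qN : N →ₗ[k] B ⊗[k] V := q.restrictScalars k ∘ₗ N.subtype
  obtain ⟨g, hg⟩ := exists_generalized_inverse (V := N) (W := B ⊗[k] V) qN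
  obtain ⟨pr, hpr⟩ := X.isInternal.exists_linearMap fun i =>
    if i = e then (LinearMap.id : R →ₗ[k] R) else 0
  -- `g` inverts `q` on its values on `N`, so that `d + θ` is annihilated by `q` in degree `e`
  let θ : W →ₗ[k] B ⊗[k] R := -(N.subtype ∘ₗ g ∘ₗ q.restrictScalars k ∘ₗ d.restrictScalars k ∘ₗ
    TensorProduct.mk k B R 1 ∘ₗ pr ∘ₗ W.subtype)
  have hθ : ∀ w, θ w = -(g (q (d (1 ⊗ₜ pr w))) : B ⊗[k] R) := fun _ => rfl
  have hθ0 : ∀ i ≠ e, ∀ w : W, (w : R) ∈ X.gr i → θ w = 0 := fun i hi w hw => by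
    rw [hθ, hpr i w hw, if_neg hi]
    simp
  have hθN : ∀ w, θ w ∈ N := fun w => by
    rw [hθ]
    exact neg_mem (g _).2
  obtain ⟨D, hD, hDθ⟩ := hW.exists_isGradedDerivation hWgr θ (fun i w hw => by
    rcases eq_or_ne i e with rfl | hi
    · exact (hθN w).1
    · rw [hθ0 i hi w hw]
      exact zero_mem _)
  have hmulD : ∀ {i : ℤ} {a : R}, a ∈ X.gr i → ∀ b : R, D ((1 : B) ⊗ₜ (a * b)) =
      D (1 ⊗ₜ a) * 1 ⊗ₜ b + (1 * i).negOnePow • (1 ⊗ₜ a * D (1 ⊗ₜ b)) := fun {i a} ha b => by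
    rw [← hD.leibniz (Submodule.tmul_mem_baseChange_of_mem _ ha),
      Algebra.TensorProduct.tmul_mul_tmul, one_mul]
  have hDred : ∀ x, reduction k B R (D x) = 0 := by
    have h1 : ∀ a : R, reduction k B R (D (1 ⊗ₜ a)) = 0 := by
      refine fun a => X.isInternal.induction (p := fun a => reduction k B R (D (1 ⊗ₜ a)) = 0)
        (fun i a ha => ?_) (by simp) (fun x y hx hy => by
          rw [TensorProduct.tmul_add, map_add, map_add, hx, hy, add_zero]) a
      refine hW.homogeneous_induction X.isInternal X.mul_mem hWgr
        (p := fun _ a => reduction k B R (D (1 ⊗ₜ a)) = 0) (by simp)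
        (fun i x y hx hy => by
          rw [TensorProduct.tmul_add, map_add, map_add, hx, hy, add_zero])
        (fun i c x hx => ?_) (fun i w hw _ => ?_) (fun i j a b ha hb hDa hDb => ?_) ha
      · rw [TensorProduct.tmul_smul, ← algebraMap_smul B c ((1 : B) ⊗ₜ[k] x), map_smul,
          reduction_smul, hx, smul_zero]
      · rw [hDθ ⟨w, hw⟩, reduction_eq_zero_iff]
        exact (hθN ⟨w, hw⟩).2
      · rw [hmulD ha, map_add, reduction_negOnePow_smul, reduction_mul, reduction_mul, hDa, hDb]
        simp
    intro x
    induction x with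
    | zero => simp
    | add x y hx hy => rw [map_add, map_add, hx, hy, add_zero]
    | tmul b a =>
      have : b ⊗ₜ[k] a = b • ((1 : B) ⊗ₜ[k] a) := by
        rw [TensorProduct.smul_tmul', smul_eq_mul, mul_one]
      rw [this, map_smul, reduction_smul, h1, smul_zero]
  have hDgr : ∀ {i : ℤ} {a : R}, a ∈ X.gr i → e < i → D (1 ⊗ₜ a) = 0 := by
    refine hW.homogeneous_induction X.isInternal X.mul_mem hWgr
        (p := fun i a => e < i → D (1 ⊗ₜ a) = 0) (by simp)
        (fun i x y hx hy hi => by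
          rw [TensorProduct.tmul_add, map_add, hx hi, hy hi, add_zero])
        (fun i c x hx hi => ?_) (fun i w hw hwi hi => ?_) (fun i j a b ha hb hDa hDb hij => ?_)
    · rw [TensorProduct.tmul_smul, ← algebraMap_smul B c ((1 : B) ⊗ₜ[k] x), map_smul, hx hi,
        smul_zero]
    · rw [hDθ ⟨w, hw⟩]
      exact hθ0 i hi.ne' ⟨w, hw⟩ hwi
    · -- a nonzero product has factors of non-positive degrees, hence of degrees `> e`
      rcases lt_or_ge 0 i with hi | hi
      · rw [hX i hi, Submodule.mem_bot] at ha
        simp [ha]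
      rcases lt_or_ge 0 j with hj | hj
      · rw [hX j hj, Submodule.mem_bot] at hb
        simp [hb]
      rw [hmulD ha, hDa (by omega), hDb (by omega)]
      simp
  refine ⟨d + D, ⟨hd.isDerivation.add hD, fun x => ?_⟩, fun i hi x hx => ?_, fun w hw hwe => ?_⟩
  · rw [LinearMap.add_apply, map_add, hDred, hd.reduction_eq, add_zero]
  · rw [LinearMap.add_apply, add_eq_left]
    exact X.eq_zero_of_mem_grB D (fun a ha => hDgr ha hi) hx
  · obtain ⟨x, hx, hxm, hxq⟩ := hq w hw hwe
    have hgx : q (g (q x) : B ⊗[k] R) = q x := hg ⟨x, hx, hxm⟩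
    have hprw : pr w = w := by
      rw [hpr e w hwe, if_pos rfl]
      rfl
    rw [LinearMap.add_apply, hDθ ⟨w, hw⟩, hθ, map_add, map_neg]
    change _ + -q (g (q (d (1 ⊗ₜ pr w))) : B ⊗[k] R) = 0
    rw [hprw, ← hxq, hgx, add_neg_cancel]

end Perturbation

section Construction

variable {k A R B : Type u} [Field k]
  [NonUnitalRing A] [Module k A] [IsScalarTower k A A] [SMulCommClass k A A]
  [NonUnitalRing R] [Module k R] [IsScalarTower k R R] [SMulCommClass k R R]
  [CommRing B] [IsLocalRing B] [Algebra k B] [HasResidueField k B]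
  {X : FreeResolution k A R} {W : Submodule k R} {ε : R →ₙₐ[k] A}
  {q : (B ⊗[k] R) →ₗ[B] B ⊗[k] A} {d : (B ⊗[k] R) →ₗ[B] (B ⊗[k] R)}

lemma FreeResolution.augmentation_eq_zero_iff
    (hε0 : ∀ z : X.cocycles, ε z = X.augmentation (X.toH0 z)) {a : R} (ha : a ∈ X.gr 0) :
    ε a = 0 ↔ ∃ b ∈ X.gr (-1), X.d b = a := by
  rw [hε0 ⟨a, X.mem_cocycles ha⟩, ← map_zero X.augmentation,
    X.augmentation_bijective.1.eq_iff, X.toH0_eq_zero_iff]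

/-- A perturbation `d` of the differential together with the lift `q : R_B → A_B` of the
augmentation is a complex in degrees `≥ -n`. -/
structure IsComplexUpTo (X : FreeResolution k A R) (q : (B ⊗[k] R) →ₗ[B] B ⊗[k] A) (n : ℕ)
    (d : (B ⊗[k] R) →ₗ[B] (B ⊗[k] R)) : Prop where
  isPerturbation : X.IsPerturbation d
  augmentation_d : ∀ x ∈ X.grB B (-1), q (d x) = 0
  d_d : ∀ i : ℤ, -n ≤ i → ∀ x ∈ X.grB B i, d (d x) = 0

/-- Exactness of `R_B⁻¹ → R_B⁰ → A_B` in the middle. -/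
lemma exists_primitive_degree_zero (hm : IsNilpotent (maximalIdeal B))
    (hε0 : ∀ z : X.cocycles, ε z = X.augmentation (X.toH0 z))
    (hq : ∀ x, reduction k B A (q x) = ε (reduction k B R x))
    (hd : X.IsPerturbation d) (hqd : ∀ x ∈ X.grB B (-1), q (d x) = 0) (n : ℕ) {y : B ⊗[k] R}
    (hy : y ∈ X.grB B 0) (hyn : y ∈ maximalIdeal B ^ n • (⊤ : Submodule B (B ⊗[k] R)))
    (hqy : q y = 0) :
    ∃ x ∈ X.grB B (-1), x ∈ maximalIdeal B ^ n • (⊤ : Submodule B (B ⊗[k] R)) ∧ d x = y := by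
  have hdeg : ∀ x ∈ X.grB B (-1), d x ∈ X.grB B 0 := fun x hx => by
    simpa using hd.isDerivation.map_mem hx
  exact exists_primitive_of_exact hm (f := X.d) (g := (ε : R →ₗ[k] A)) (U₂ := X.gr (-1))
    (U₁ := X.gr 0) (fun _ hu h => (X.augmentation_eq_zero_iff hε0 hu).1 h) (F := d) (G := q)
    hd.reduction_eq hq hdeg hqd n hy hyn hqy

/-- Exactness of `R_B⁰ → A_B → 0`, on each step of the `𝔪`-adic filtration. -/
lemma exists_preimage_augmentation (hm : IsNilpotent (maximalIdeal B))
    (hε0 : ∀ z : X.cocycles, ε z = X.augmentation (X.toH0 z))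
    (hq : ∀ x, reduction k B A (q x) = ε (reduction k B R x)) (n : ℕ) {y : B ⊗[k] A}
    (hyn : y ∈ maximalIdeal B ^ n • (⊤ : Submodule B (B ⊗[k] A))) :
    ∃ x ∈ X.grB B 0, x ∈ maximalIdeal B ^ n • (⊤ : Submodule B (B ⊗[k] R)) ∧ q x = y := by
  refine exists_primitive_of_exact hm (f := (ε : R →ₗ[k] A)) (g := (0 : A →ₗ[k] A))
    (U₂ := X.gr 0) (U₁ := ⊤) (fun a _ _ => ?_) (G := 0) hq (by simp) (by simp) (by simp) n
    (by simp) hyn rfl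
  obtain ⟨y, rfl⟩ := X.augmentation_bijective.2 a
  obtain ⟨z, rfl⟩ := X.toH0_surjective y
  exact ⟨z, z.2.1, hε0 z⟩

/-- The complex is exact in all degrees but the lowest one. -/
lemma IsComplexUpTo.exists_primitive (hm : IsNilpotent (maximalIdeal B))
    (hε0 : ∀ z : X.cocycles, ε z = X.augmentation (X.toH0 z))
    (hq : ∀ x, reduction k B A (q x) = ε (reduction k B R x)) {n : ℕ}
    (hd : IsComplexUpTo X q n d) {i : ℤ} (hi : -(n : ℤ) ≤ i) (hi0 : i < 0) (l : ℕ) {y : B ⊗[k] R}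
    (hy : y ∈ X.grB B (i + 1)) (hyl : y ∈ maximalIdeal B ^ l • (⊤ : Submodule B (B ⊗[k] R)))
    (hdy : d y = 0) (hqy : i = -1 → q y = 0) :
    ∃ x ∈ X.grB B i, x ∈ maximalIdeal B ^ l • (⊤ : Submodule B (B ⊗[k] R)) ∧ d x = y := by
  rcases eq_or_ne i (-1) with rfl | hi1
  · exact exists_primitive_degree_zero hm hε0 hq hd.isPerturbation hd.augmentation_d l
      (by simpa using hy) hyl (hqy rfl)
  · refine exists_primitive_of_exact hm (f := X.d) (g := X.d) (U₂ := X.gr i) (U₁ := X.gr (i + 1))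
      (fun u hu h => ?_) hd.isPerturbation.reduction_eq hd.isPerturbation.reduction_eq
      (fun _ hx => hd.isPerturbation.isDerivation.map_mem hx) (hd.d_d i hi) l hy hyl hdy
    obtain ⟨b, hb, hbu⟩ := X.acyclic (i + 1) (by omega) u hu h
    exact ⟨b, by simpa using hb, hbu⟩

lemma DGAlgebraStr.IsPerturbation.map_tmul_mul {X : DGAlgebraStr k R} (hd : X.IsPerturbation d)
    {i : ℤ} {a : R} (ha : a ∈ X.gr i) (b : R) : d ((1 : B) ⊗ₜ (a * b)) =
      d (1 ⊗ₜ a) * 1 ⊗ₜ b + i.negOnePow • (1 ⊗ₜ a * d (1 ⊗ₜ b)) := by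
  have := hd.isDerivation.leibniz (Submodule.tmul_mem_baseChange_of_mem (1 : B) ha)
    ((1 : B) ⊗ₜ[k] b)
  rwa [one_mul, Algebra.TensorProduct.tmul_mul_tmul, one_mul] at this

/-- The differential of `R_B` is modified on the generators of degree `-1` to get a complex
`R_B⁻¹ → R_B⁰ → A_B`. -/
lemma exists_isComplexUpTo_one (hm : IsNilpotent (maximalIdeal B)) (hW : FreelyGenerates W)
    (hWgr : W = ⨆ i, W ⊓ X.gr i) (hε0 : ∀ z : X.cocycles, ε z = X.augmentation (X.toH0 z))
    (hq : ∀ x, reduction k B A (q x) = ε (reduction k B R x))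
    (hqker : ∀ x y, q x = 0 → q (x * y) = 0 ∧ q (y * x) = 0) :
    ∃ d : (B ⊗[k] R) →ₗ[B] (B ⊗[k] R), IsComplexUpTo X q 1 d := by
  have hs : X.IsPerturbation (X.d.baseChange B) :=
    ⟨X.isGradedDerivation_baseChange, fun x => reduction_baseChange _ _⟩
  obtain ⟨d, hd, -, hqd⟩ := hs.exists_modification X.nonpos hW hWgr q (-1) (fun w hw hw1 => by
    have hdw : X.d w ∈ X.gr 0 := by simpa using X.isDerivation.map_mem hw1
    obtain ⟨x, hx, hxm, hxq⟩ := exists_preimage_augmentation hm hε0 hq 1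
      (y := q (X.d.baseChange B (1 ⊗ₜ w))) (by
        rw [pow_one, ← reduction_eq_zero_iff (k := k), hq, reduction_baseChange, reduction_tmul,
          map_one, one_smul]
        exact (X.augmentation_eq_zero_iff hε0 hdw).2 ⟨w, hw1, rfl⟩)
    exact ⟨x, by simpa using hx, by simpa using hxm, hxq⟩)
  refine ⟨d, hd, fun x hx => ?_, fun i hi x hx => ?_⟩
  · refine X.eq_zero_of_mem_grB (q ∘ₗ d) (fun a ha => ?_) hx
    change q (d (1 ⊗ₜ a)) = 0
    have key : ∀ {i : ℤ} {a : R}, a ∈ X.gr i → i = -1 → q (d (1 ⊗ₜ a)) = 0 := by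
      refine hW.homogeneous_induction X.isInternal X.mul_mem hWgr
        (p := fun i a => i = -1 → q (d (1 ⊗ₜ a)) = 0) (by simp)
        (fun i x y hx hy hi => by
          rw [TensorProduct.tmul_add, map_add, map_add, hx hi, hy hi, add_zero])
        (fun i c x hx hi => ?_) (fun i w hw hwi hi => ?_) (fun i j a b ha hb hDa hDb hij => ?_)
      · rw [TensorProduct.tmul_smul, ← algebraMap_smul B c ((1 : B) ⊗ₜ[k] x), map_smul, map_smul,
          hx hi, smul_zero]
      · exact hqd w hw (hi ▸ hwi)
      · -- one factor has degree `-1` and the other one degree `0`, unless the product vanishes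
        have hzero : ∀ i, -1 < i → ∀ a ∈ X.gr i, d ((1 : B) ⊗ₜ a) = 0 := fun i hi a ha =>
          X.grB_eq_zero (by omega)
            (hd.isDerivation.map_mem (Submodule.tmul_mem_baseChange_of_mem (1 : B) ha))
        have hfac : ∀ i, -1 ≤ i → ∀ a ∈ X.gr i, (i = -1 → q (d (1 ⊗ₜ a)) = 0) →
            q (d (1 ⊗ₜ a)) = 0 := fun i hi a ha h => by
          rcases hi.eq_or_lt with hi | hi
          · exact h hi.symm
          · rw [hzero i hi a ha, map_zero]
        rcases lt_or_ge 0 i with hi | hi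
        · rw [X.nonpos i hi, Submodule.mem_bot] at ha
          simp [ha]
        rcases lt_or_ge 0 j with hj | hj
        · rw [X.nonpos j hj, Submodule.mem_bot] at hb
          simp [hb]
        have h1 := (hqker _ (1 ⊗ₜ b) (hfac i (by omega) a ha hDa)).1
        have h2 := (hqker _ (1 ⊗ₜ a) (hfac j (by omega) b hb hDb)).2
        rw [hd.map_tmul_mul ha, map_add, h1, zero_add]
        rcases Int.units_eq_one_or i.negOnePow with h | h <;> simp [h, Units.neg_smul, h2]
    exact key ha rfl
  · exact X.grB_eq_zero (i := i + 1 + 1) (by push_cast at hi; omega)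
      (hd.isDerivation.map_mem (hd.isDerivation.map_mem hx))

/-- The differential of a complex in degrees `≥ -n` is modified on the generators of degree
`-n-1`. Its square on such a generator is a cocycle in `𝔪 R_B`, hence the boundary of an
element of `𝔪 R_B`, which is subtracted. -/
lemma IsComplexUpTo.exists_succ (hm : IsNilpotent (maximalIdeal B)) (hW : FreelyGenerates W)
    (hWgr : W = ⨆ i, W ⊓ X.gr i) (hε0 : ∀ z : X.cocycles, ε z = X.augmentation (X.toH0 z))
    (hq : ∀ x, reduction k B A (q x) = ε (reduction k B R x)) {n : ℕ} (hn : 1 ≤ n)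
    (hd : IsComplexUpTo X q n d) :
    ∃ d' : (B ⊗[k] R) →ₗ[B] (B ⊗[k] R), IsComplexUpTo X q (n + 1) d' ∧
      ∀ i : ℤ, -n ≤ i → ∀ x ∈ X.grB B i, d' x = d x := by
  have hdp := hd.isPerturbation
  obtain ⟨d', hd', hdd', hqd⟩ := hdp.exists_modification X.nonpos hW hWgr d (-n - 1)
    (fun w hw hwe => by
      have hdw : d (1 ⊗ₜ w) ∈ X.grB B (-n) := by
        simpa using hdp.isDerivation.map_mem (Submodule.tmul_mem_baseChange_of_mem (1 : B) hwe)
      obtain ⟨x, hx, hxm, hxd⟩ := hd.exists_primitive hm hε0 hq (i := -n) le_rfl (by omega) 1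
        (hdp.isDerivation.map_mem hdw) (by
          rw [pow_one, ← reduction_eq_zero_iff (k := k), hdp.reduction_eq, hdp.reduction_eq,
            X.d_d])
        (hd.d_d _ le_rfl _ hdw) (fun h => hd.augmentation_d _ (h ▸ hdw))
      exact ⟨x, by simpa using hx, by simpa using hxm, hxd⟩)
  have hagree : ∀ i : ℤ, -n ≤ i → ∀ x ∈ X.grB B i, d' x = d x := fun i hi =>
    hdd' i (by omega)
  refine ⟨d', ⟨hd', fun x hx => ?_, fun i hi x hx => ?_⟩, hagree⟩
  · rw [hagree (-1) (by omega) x hx]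
    exact hd.augmentation_d x hx
  · refine X.eq_zero_of_mem_grB (d' ∘ₗ d') (fun a ha => ?_) hx
    change d' (d' (1 ⊗ₜ a)) = 0
    have key : ∀ {i : ℤ} {a : R}, a ∈ X.gr i → -(n : ℤ) - 1 ≤ i → d' (d' (1 ⊗ₜ a)) = 0 := by
      refine hW.homogeneous_induction X.isInternal X.mul_mem hWgr
        (p := fun i a => -(n : ℤ) - 1 ≤ i → d' (d' (1 ⊗ₜ a)) = 0) (by simp)
        (fun i x y hx hy hi => by
          rw [TensorProduct.tmul_add, map_add, map_add, hx hi, hy hi, add_zero])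
        (fun i c x hx hi => ?_) (fun i w hw hwi hi => ?_) (fun i j a b ha hb hDa hDb hij => ?_)
      · rw [TensorProduct.tmul_smul, ← algebraMap_smul B c ((1 : B) ⊗ₜ[k] x), map_smul, map_smul,
          hx hi, smul_zero]
      · have hw' := Submodule.tmul_mem_baseChange_of_mem (1 : B) hwi
        rw [hagree (i + 1) (by omega) _ (hd'.isDerivation.map_mem hw')]
        rcases hi.eq_or_lt with hi | hi
        · exact hqd w hw (hi ▸ hwi)
        · rw [hagree i (by omega) _ hw']
          exact hd.d_d i (by omega) _ hw'
      · rcases lt_or_ge 0 i with hi | hi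
        · rw [X.nonpos i hi, Submodule.mem_bot] at ha
          simp [ha]
        rcases lt_or_ge 0 j with hj | hj
        · rw [X.nonpos j hj, Submodule.mem_bot] at hb
          simp [hb]
        have := hd'.isDerivation.sq_mul (Submodule.tmul_mem_baseChange_of_mem (1 : B) ha)
          ((1 : B) ⊗ₜ[k] b)
        rw [Algebra.TensorProduct.tmul_mul_tmul, one_mul, hDa (by omega), hDb (by omega)] at this
        simpa using this
    exact key ha (by push_cast at hi; omega)

/-- The modifications in degrees `-1, -2, …` stabilize in each degree and define a deformation of
the relations whose differential is annihilated by the lift `q` of the augmentation. -/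
lemma exists_relDeformation (hm : IsNilpotent (maximalIdeal B)) (hW : FreelyGenerates W)
    (hWgr : W = ⨆ i, W ⊓ X.gr i) (hε0 : ∀ z : X.cocycles, ε z = X.augmentation (X.toH0 z))
    (hq : ∀ x, reduction k B A (q x) = ε (reduction k B R x))
    (hqker : ∀ x y, q x = 0 → q (x * y) = 0 ∧ q (y * x) = 0) :
    ∃ D : RelDeformation B X, X.IsPerturbation D.perturbed.d ∧
      ∀ x ∈ X.grB B (-1), q (D.perturbed.d x) = 0 := by
  obtain ⟨d₁, hd₁⟩ := exists_isComplexUpTo_one hm hW hWgr hε0 hq hqker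
  choose next hnext hagree using
    fun (n : ℕ) (d : {d : (B ⊗[k] R) →ₗ[B] (B ⊗[k] R) // IsComplexUpTo X q (n + 1) d}) =>
      d.2.exists_succ hm hW hWgr hε0 hq (Nat.le_add_left 1 n)
  -- `seq n` is a complex in degrees `≥ -(n + 1)` and agrees with `seq (n + 1)` there
  let seq : ∀ n : ℕ, {d : (B ⊗[k] R) →ₗ[B] (B ⊗[k] R) // IsComplexUpTo X q (n + 1) d} :=
    fun n => Nat.rec ⟨d₁, hd₁⟩ (fun n d => ⟨next n d, hnext n d⟩) n
  have hseq : ∀ n : ℕ, ∀ i : ℤ, -(n : ℤ) - 1 ≤ i → ∀ x ∈ X.grB B i,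
      (seq (n + 1)).1 x = (seq n).1 x := fun n i hi x hx =>
    hagree n (seq n) i (by push_cast; omega) x hx
  have hstab : ∀ i : ℤ, ∀ n, (-i).toNat ≤ n → ∀ x ∈ X.grB B i,
      (seq n).1 x = (seq (-i).toNat).1 x := by
    intro i n hn x hx
    induction n, hn using Nat.le_induction with
    | base => rfl
    | succ n hn ih => rw [hseq n i (by omega) x hx, ih]
  have hint : DirectSum.IsInternal (X.grB B) := X.isInternal.baseChange
  obtain ⟨d, hdef⟩ := hint.exists_linearMap fun i => (seq (-i).toNat).1
  have hd : ∀ i : ℤ, ∀ n, (-i).toNat ≤ n → ∀ x ∈ X.grB B i, d x = (seq n).1 x :=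
    fun i n hn x hx => by rw [hdef i x hx, hstab i n hn x hx]
  have hder : IsGradedDerivation (X.grB B) 1 d := by
    refine ⟨fun {i a} ha => ?_, fun {i a} ha b => ?_⟩
    · rw [hdef i a ha]
      exact (seq _).2.isPerturbation.isDerivation.map_mem ha
    · refine hint.induction (p := fun b => d (a * b) = d a * b + (1 * i).negOnePow • (a * d b))
        (fun j b hb => ?_) (by simp) (fun x y hx hy => ?_) b
      · let n := max (max (-i).toNat (-j).toNat) (-(i + j)).toNat
        rw [hd (i + j) n (by omega) _ (X.grB_mul_mem ha hb), hd i n (by omega) a ha,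
          hd j n (by omega) b hb]
        exact (seq n).2.isPerturbation.isDerivation.leibniz ha b
      · rw [mul_add, map_add, hx, hy, map_add, mul_add, mul_add, smul_add]
        abel
  have hred : ∀ x, reduction k B R (d x) = X.d (reduction k B R x) :=
    fun x => hint.induction (p := fun x => reduction k B R (d x) = X.d (reduction k B R x))
      (fun i x hx => by rw [hdef i x hx]; exact (seq _).2.isPerturbation.reduction_eq x)
      (by simp) (fun x y hx hy => by simp only [map_add, hx, hy]) x
  have hdd : ∀ x, d (d x) = 0 :=
    fun x => hint.induction (p := fun x => d (d x) = 0)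
      (fun i x hx => by
        rw [hd (i + 1) (-i).toNat (by omega) _ (hder.map_mem hx), hdef i x hx]
        exact (seq _).2.d_d i (by push_cast; omega) x hx)
      (by simp) (fun x y hx hy => by simp only [map_add, hx, hy, add_zero]) x
  let D : RelDeformation B X :=
    { δ := d - X.d.baseChange B
      isDerivation := hder.sub X.isGradedDerivation_baseChange
      range_le := by
        rintro _ ⟨x, rfl⟩
        rw [← reduction_eq_zero_iff (k := k), LinearMap.sub_apply, map_sub, hred,
          reduction_baseChange, sub_self]
      sq_zero := fun x => by simpa using hdd x }
  have hD : D.perturbed.d = d := LinearMap.ext fun x => by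
    change X.d.baseChange B x + (d x - X.d.baseChange B x) = d x
    rw [add_sub_cancel]
  refine ⟨D, hD ▸ ⟨hder, hred⟩, fun x hx => ?_⟩
  rw [hD, hdef (-1) x hx]
  exact (seq _).2.augmentation_d x hx

end Construction

/-! ### Surjectivity -/

section Surjectivity

variable {k A B : Type u} [Field k]
  [NonUnitalRing A] [Module k A] [IsScalarTower k A A] [SMulCommClass k A A]
  [CommRing B] [IsLocalRing B] [Algebra k B] [HasResidueField k B]

/-- The canonical map `Ã → A` as a map which is linear over `B → k`. -/
noncomputable def FlatDeformation.toFibreₛₗ (E : FlatDeformation k A B) :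
    E.carrier →ₛₗ[(residueMap k B : B →+* k)] A where
  toFun := E.toFibre
  map_add' x y := by
    rw [FlatDeformation.toFibre, TensorProduct.tmul_add, map_add]
    rfl
  map_smul' b x := by
    have h : (1 : ResidueField B) ⊗ₜ[B] (b • x) =
        residueMap k B b • ((1 : ResidueField B) ⊗ₜ[B] x) := by
      rw [← TensorProduct.smul_tmul, TensorProduct.smul_tmul']
      congr 1
      rw [Algebra.smul_def, Algebra.smul_def, mul_one, mul_one]
      exact (residueEquiv_residueMap k B b).symm
    rw [FlatDeformation.toFibre, h, map_smul]
    rfl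

lemma FlatDeformation.toFibre_mul (E : FlatDeformation k A B) (x y : E.carrier) :
    E.toFibre (x * y) = E.toFibre x * E.toFibre y := by
  rw [toFibre, toFibre, toFibre, ← map_mul, Algebra.TensorProduct.tmul_mul_tmul, one_mul]

lemma FlatDeformation.toFibre_surjective (E : FlatDeformation k A B) :
    Function.Surjective E.toFibre := by
  intro a
  obtain ⟨y, rfl⟩ := E.fibre_bijective.2 a
  obtain ⟨x, rfl⟩ := exists_one_tmul y
  exact ⟨x, rfl⟩

lemma FlatDeformation.mem_smul_of_toFibre_eq_zero (E : FlatDeformation k A B) {x : E.carrier}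
    (hx : E.toFibre x = 0) : x ∈ maximalIdeal B • (⊤ : Submodule B E.carrier) := by
  refine mem_smul_top_of_one_tmul_eq_zero (E.fibre_bijective.1 ?_)
  rw [map_zero]
  exact hx

variable {R : Type u} [NonUnitalRing R] [Module k R] [IsScalarTower k R R] [SMulCommClass k R R]

/-- Every flat deformation is the cohomology of a deformation of the relations. -/
lemma FlatDeformation.exists_equivalent_toFlatDeformation [IsArtinianRing B]
    (X : FreeResolution k A R) (E : FlatDeformation k A B) :
    ∃ D : RelDeformation B X, D.toFlatDeformation.Equivalent E := by
  have hm := isNilpotent_maximalIdeal B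
  have := E.flat
  obtain ⟨W, hWgr, hW⟩ := X.free
  have hW : FreelyGenerates W := hW
  obtain ⟨ε, hε0⟩ := X.exists_augmentation
  obtain ⟨p, hpmul, hp⟩ :=
    hW.exists_augmentation_lift (B := B) ε E.toFibreₛₗ E.toFibre_surjective E.toFibre_mul
  obtain ⟨e, he⟩ := exists_linearEquiv_of_flat hm E.toFibreₛₗ E.toFibre_surjective
    fun _ => E.mem_smul_of_toFibre_eq_zero
  let q : (B ⊗[k] R) →ₗ[B] B ⊗[k] A := e.toLinearMap ∘ₗ p
  have hq0 : ∀ x, q x = 0 ↔ p x = 0 := fun x => e.map_eq_zero_iff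
  have hq : ∀ x, reduction k B A (q x) = ε (reduction k B R x) := fun x => (he _).trans (hp x)
  obtain ⟨D, hD, hqD⟩ := exists_relDeformation hm hW hWgr hε0 hq (fun x y h => by
    rw [hq0] at h ⊢
    rw [hq0, hpmul, hpmul, h, zero_mul, mul_zero]
    exact ⟨rfl, rfl⟩)
  let F : D.perturbed.H0 →ₗ[B] E.carrier :=
    D.perturbed.liftH0 (p ∘ₗ
      { toFun := fun z => (z : B ⊗[k] R)
        map_add' := fun _ _ => rfl
        map_smul' := fun _ _ => rfl }) (by
      rintro z ⟨b, hb, hz⟩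
      change p z = 0
      rw [← hz, ← hq0]
      exact hqD b hb)
  have hF : ∀ z, F (D.perturbed.toH0 z) = p z := fun _ => rfl
  let Φ : D.perturbed.H0 →ₙₐ[B] E.carrier :=
    { toFun := F
      map_smul' := fun b x => map_smul F b x
      map_zero' := map_zero F
      map_add' := map_add F
      map_mul' := fun x y => by
        obtain ⟨z, rfl⟩ := D.perturbed.toH0_surjective x
        obtain ⟨w, rfl⟩ := D.perturbed.toH0_surjective y
        rw [← DGAlgebraStr.toH0_mul, hF, hF, hF]
        exact hpmul _ _ }
  refine ⟨D, Φ, ⟨?_, ?_⟩, ?_⟩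
  · change Function.Injective F
    rw [injective_iff_map_eq_zero]
    intro x hx
    obtain ⟨z, rfl⟩ := D.perturbed.toH0_surjective x
    rw [hF, ← hq0] at hx
    obtain ⟨x, hx, -, hxz⟩ := exists_primitive_degree_zero hm hε0 hq hD hqD 0 z.2.1 (by simp) hx
    exact D.perturbed.toH0_eq_zero_iff.2 ⟨x, hx, hxz⟩
  · change Function.Surjective F
    intro y
    obtain ⟨x, hx, -, hxy⟩ := exists_preimage_augmentation hm hε0 hq 0 (y := e y) (by simp)
    refine ⟨D.perturbed.toH0 ⟨x, D.mem_cocycles hx⟩, ?_⟩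
    rw [hF]
    exact e.injective hxy
  · intro x
    refine Eq.trans ?_ (D.toFlatDeformation_toFibre x).symm
    obtain ⟨z, rfl⟩ := D.perturbed.toH0_surjective x
    rw [RelDeformation.toFibre_toH0, ← hε0]
    exact hp _

end Surjectivity

theorem mainTheorem4 {k A R : Type u} [Field k] [CharZero k]
    [NonUnitalRing A] [Module k A] [IsScalarTower k A A] [SMulCommClass k A A]
    [NonUnitalRing R] [Module k R] [IsScalarTower k R R] [SMulCommClass k R R]
    (X : FreeResolution k A R)
    (B : Type u) [CommRing B] [IsLocalRing B] [IsArtinianRing B] [Algebra k B]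
    [HasResidueField k B] :
    Function.Surjective (relToFlat X B) := by
  intro c
  obtain ⟨E, rfl⟩ := Quotient.exists_rep c
  obtain ⟨D, hD⟩ := E.exists_equivalent_toFlatDeformation X
  exact ⟨Quotient.mk _ D, Quotient.sound hD⟩
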